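/- **Theorem.** All manifolds are smooth, finite dimensional and without boundary. Let $(\overline M,\overline g)$ be a Riemannian manifold with Levi-Civita connection $\overline\nabla$, let $p,q\ge 1$ be integers, and let $J$ be a smooth $(1,1)$-tensor field on $\overline M$ with $$J^2=pJ+qI,\qquad \overline g(JX,Y)=\overline g(X,JY),\qquad \overline\nabla J=0,$$ i.e. $(\overline M,\overline g,J)$ is a locally metallic Riemannian manifold (locally Golden if $p=q=1$). Let $i:M\to\overline M$ be an isometric immersion of a Riemannian manifold $(M,g)$ with Levi-Civita connection $\nabla$; identify $X\in TM$ with $i_*X$ and write $JX=TX+NX$ with $TX$ tangent and $NX$ normal to $M$. Assume that $M$ is a semi-slant submanifold: there are differentiable distributions $D_1,D_2$ on $M$ such that $TM=D_1\oplus D_2$ is an orthogonal decomposition, $J(D_1)=D_1$, and $D_2$ is a slant distribution with slant angle $\theta\neq 0$, i.e. for all $x\in M$ and $0\ne X\in (D_2)_x$ the angle between $JX$ and the subspace $(D_2)_x$ equals the constant $\theta$. Let $P_1$ be the orthogonal projection of $TM$ onto $D_1$. A distribution $D$ on $M$ is called integrable if $[X,Y]\in\Gamma(D)$ for all $X,Y\in\Gamma(D)$.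 Fix smooth local orthonormal frames $(N_1,\dots,N_r)$ of the normal bundle of $M$ in $\overline M$, over open sets that cover $M$. For each of these frames let $u_\alpha(X)=\overline g(JX,N_\alpha)$, so that $NX=\sum_{\alpha=1}^r u_\alpha(X)N_\alpha$, let $(\nabla_Xu_\alpha)(Y)=X(u_\alpha(Y))-u_\alpha(\nabla_XY)$, and let $A_\alpha X$ be minus the tangential part of $\overline\nabla_XN_\alpha$ (the shape operator of $N_\alpha$). Then: (i) $D_1$ is integrable if and only if, for all $X,Y\in\Gamma(D_1)$ and all $\alpha\in\{1,\dots,r\}$, $$(\nabla_Yu_\alpha)(X)=(\nabla_Xu_\alpha)(Y)$$ on the domain of each of the frames; (ii) $D_2$ is integrable if and only if, for all $X,Y\in\Gamma(D_2)$, $$P_1(\nabla_XTY-\nabla_YTX)=\sum_{\alpha=1}^r\bigl[u_\alpha(Y)P_1(A_\alpha X)-u_\alpha(X)P_1(A_\alpha Y)\bigr]$$ on the domain of each of the frames. -/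

import Mathlib

open Bundle
open scoped Manifold ContDiff

namespace SemiSlant

noncomputable section

/-! ### Riemannian manifolds, distributions and metallic structures

Manifolds are smooth, finite dimensional and without boundary, modelled on a normed space `E`.
A Riemannian metric is a `RiemannianBundle` structure on the tangent bundle, smooth in the sense
of `IsContMDiffRiemannianBundle`. -/

section OneManifold

variable {E : Type*} [NormedAddCommGroup E] [NormedSpace ℝ E]
  {M : Type*} [TopologicalSpace M] [ChartedSpace E M]

instance instFiniteDimensionalTangentSpace [FiniteDimensional ℝ E] (x : M) : FiniteDimensional ℝ (TangentSpace 𝓘(ℝ, E) x) :=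
  inferInstanceAs (FiniteDimensional ℝ E)

/-- `X` is a smooth vector field on `M`. -/
def IsSmoothField [IsManifold 𝓘(ℝ, E) ∞ M] (X : Π x : M, TangentSpace 𝓘(ℝ, E) x) : Prop :=
  ContMDiff 𝓘(ℝ, E) 𝓘(ℝ, E).tangent ∞ (fun x ↦ (⟨x, X x⟩ : TangentBundle 𝓘(ℝ, E) M))

/-- `X ∈ Γ(D)`: a smooth vector field on `M` with values in `D`. -/
def IsSmoothSection [IsManifold 𝓘(ℝ, E) ∞ M]
    (D : Π x : M, Submodule ℝ (TangentSpace 𝓘(ℝ, E) x))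
    (X : Π x : M, TangentSpace 𝓘(ℝ, E) x) : Prop :=
  IsSmoothField X ∧ ∀ x, X x ∈ D x

/-- `D` is a differentiable distribution of rank `k`: it is locally spanned by `k` smooth,
pointwise linearly independent vector fields. -/
def IsDistribution [IsManifold 𝓘(ℝ, E) ∞ M] (k : ℕ)
    (D : Π x : M, Submodule ℝ (TangentSpace 𝓘(ℝ, E) x)) : Prop :=
  ∀ x : M, ∃ U : Set M, IsOpen U ∧ x ∈ U ∧
    ∃ Z : Fin k → Π y : M, TangentSpace 𝓘(ℝ, E) y,
      (∀ i, ContMDiffOn 𝓘(ℝ, E) 𝓘(ℝ, E).tangent ∞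
        (fun y ↦ (⟨y, Z i y⟩ : TangentBundle 𝓘(ℝ, E) M)) U) ∧
      ∀ y ∈ U, LinearIndependent ℝ (fun i ↦ Z i y) ∧
        Submodule.span ℝ (Set.range fun i ↦ Z i y) = D y

/-- `D` is integrable: `[X, Y] ∈ Γ(D)` for all `X, Y ∈ Γ(D)`. -/
def IsIntegrable [IsManifold 𝓘(ℝ, E) ∞ M]
    (D : Π x : M, Submodule ℝ (TangentSpace 𝓘(ℝ, E) x)) : Prop :=
  ∀ X Y : Π x : M, TangentSpace 𝓘(ℝ, E) x, IsSmoothSection D X → IsSmoothSection D Y →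
    ∀ x, VectorField.mlieBracket 𝓘(ℝ, E) X Y x ∈ D x

variable [FiniteDimensional ℝ E] [IsManifold 𝓘(ℝ, E) ∞ M]
  [RiemannianBundle (fun x : M ↦ TangentSpace 𝓘(ℝ, E) x)]

/-- The connection `nab` is the Levi-Civita connection: it is torsion-free and metric, that is
`v(g(Y, Z)) = g(∇_v Y, Z) + g(Y, ∇_v Z)`. (`nab Y x v` is `∇_v Y` at `x`.) -/
structure IsLeviCivita
    (nab : CovariantDerivative 𝓘(ℝ, E) E (fun x : M ↦ TangentSpace 𝓘(ℝ, E) x)) : Prop where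
  torsion_eq_zero : nab.torsion = 0
  metric : ∀ (Y Z : Π x : M, TangentSpace 𝓘(ℝ, E) x) (x : M),
    MDifferentiableAt 𝓘(ℝ, E) 𝓘(ℝ, E).tangent
      (fun y ↦ (⟨y, Y y⟩ : TangentBundle 𝓘(ℝ, E) M)) x →
    MDifferentiableAt 𝓘(ℝ, E) 𝓘(ℝ, E).tangent
      (fun y ↦ (⟨y, Z y⟩ : TangentBundle 𝓘(ℝ, E) M)) x →
    ∀ v : TangentSpace 𝓘(ℝ, E) x,
      mvfderiv 𝓘(ℝ, E) (fun y ↦ inner ℝ (Y y) (Z y)) x v =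
        inner ℝ (nab Y x v) (Z x) + inner ℝ (Y x) (nab Z x v)

/-- `J` is a metallic structure with `J² = p J + q I`, where `p, q` are positive integers, and the
Riemannian metric is `J`-compatible. For `p = q = 1` this is a Golden Riemannian structure. -/
structure IsMetallicRiemannian (p q : ℕ)
    (J : Π x : M, TangentSpace 𝓘(ℝ, E) x →L[ℝ] TangentSpace 𝓘(ℝ, E) x) : Prop where
  p_pos : 0 < p
  q_pos : 0 < q
  smooth : ContMDiff 𝓘(ℝ, E) (𝓘(ℝ, E).prod 𝓘(ℝ, E →L[ℝ] E)) ∞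
    (fun x ↦ (⟨x, J x⟩ : Bundle.TotalSpace (E →L[ℝ] E)
      (fun x : M ↦ TangentSpace 𝓘(ℝ, E) x →L[ℝ] TangentSpace 𝓘(ℝ, E) x)))
  sq : ∀ (x : M) (v : TangentSpace 𝓘(ℝ, E) x), J x (J x v) = (p : ℝ) • J x v + (q : ℝ) • v
  compatible : ∀ (x : M) (v w : TangentSpace 𝓘(ℝ, E) x), inner ℝ (J x v) w = inner ℝ v (J x w)

/-- A locally metallic Riemannian manifold: `∇J = 0`, that is `∇_v (JY) = J (∇_v Y)` for all `v`
and all vector fields `Y`, where `nab` is the Levi-Civita connection. For `p = q = 1`: a locally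
Golden Riemannian manifold. -/
structure IsLocallyMetallic (p q : ℕ)
    (J : Π x : M, TangentSpace 𝓘(ℝ, E) x →L[ℝ] TangentSpace 𝓘(ℝ, E) x)
    (nab : CovariantDerivative 𝓘(ℝ, E) E (fun x : M ↦ TangentSpace 𝓘(ℝ, E) x)) : Prop where
  metallic : IsMetallicRiemannian p q J
  parallel : ∀ (Y : Π x : M, TangentSpace 𝓘(ℝ, E) x) (x : M),
    MDifferentiableAt 𝓘(ℝ, E) 𝓘(ℝ, E).tangent
      (fun y ↦ (⟨y, Y y⟩ : TangentBundle 𝓘(ℝ, E) M)) x →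
    ∀ v : TangentSpace 𝓘(ℝ, E) x, nab (fun y ↦ J y (Y y)) x v = J x (nab Y x v)

end OneManifold

/-! ### Submanifolds: `f : M → N` is the immersion, `N` the ambient manifold -/

section Immersion

variable {E : Type*} [NormedAddCommGroup E] [NormedSpace ℝ E] [FiniteDimensional ℝ E]
  {M : Type*} [TopologicalSpace M] [ChartedSpace E M] [IsManifold 𝓘(ℝ, E) ∞ M]
  [RiemannianBundle (fun x : M ↦ TangentSpace 𝓘(ℝ, E) x)]
  {F : Type*} [NormedAddCommGroup F] [NormedSpace ℝ F] [FiniteDimensional ℝ F]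
  {N : Type*} [TopologicalSpace N] [ChartedSpace F N] [IsManifold 𝓘(ℝ, F) ∞ N]
  [RiemannianBundle (fun y : N ↦ TangentSpace 𝓘(ℝ, F) y)]

/-- `f` is a smooth isometric immersion: `g(u, v) = ḡ(f_* u, f_* v)`. In particular every
differential `f_*` is injective. -/
structure IsIsometricImmersion (f : M → N) : Prop where
  contMDiff : ContMDiff 𝓘(ℝ, E) 𝓘(ℝ, F) ∞ f
  isometric : ∀ (x : M) (u v : TangentSpace 𝓘(ℝ, E) x),
    inner ℝ (mfderiv 𝓘(ℝ, E) 𝓘(ℝ, F) f x u) (mfderiv 𝓘(ℝ, E) 𝓘(ℝ, F) f x v) = inner ℝ u v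

/-- The tangent space of the submanifold, as a subspace `f_*(T_x M)` of `T_{f x} N`. -/
def tangentRange (f : M → N) (x : M) : Submodule ℝ (TangentSpace 𝓘(ℝ, F) (f x)) :=
  LinearMap.range (mfderiv 𝓘(ℝ, E) 𝓘(ℝ, F) f x).toLinearMap

/-- The tangential part `w^⊤ ∈ T_x M` of `w ∈ T_{f x} N`, for an isometric immersion `f`:
`g(w^⊤, v) = ḡ(w, f_* v)` for all `v ∈ T_x M`. -/
def tangentPart (f : M → N) (x : M) :
    TangentSpace 𝓘(ℝ, F) (f x) →ₗ[ℝ] TangentSpace 𝓘(ℝ, E) x :=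
  LinearMap.adjoint (mfderiv 𝓘(ℝ, E) 𝓘(ℝ, F) f x).toLinearMap

/-- The defining decomposition: `w - f_*(w^⊤)` is normal to the submanifold. -/
theorem sub_tangentPart_mem_normal {f : M → N} (hf : IsIsometricImmersion (E := E) (F := F) f)
    (x : M) (w : TangentSpace 𝓘(ℝ, F) (f x)) :
    w - mfderiv 𝓘(ℝ, E) 𝓘(ℝ, F) f x (tangentPart (E := E) f x w) ∈
      (tangentRange (E := E) (F := F) f x)ᗮ := by
  rw [Submodule.mem_orthogonal]
  rintro _ ⟨v, rfl⟩
  rw [inner_sub_right]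
  have h1 := LinearMap.adjoint_inner_right (mfderiv 𝓘(ℝ, E) 𝓘(ℝ, F) f x).toLinearMap v w
  have h2 := hf.isometric x v (tangentPart (E := E) f x w)
  rw [← h1]
  exact sub_eq_zero.2 h2.symm

/-- The `(1,1)`-tensor `T` on `M`: `TX = (JX)^⊤`. -/
def tangT (J : Π y : N, TangentSpace 𝓘(ℝ, F) y →L[ℝ] TangentSpace 𝓘(ℝ, F) y)
    (f : M → N) (x : M) (v : TangentSpace 𝓘(ℝ, E) x) : TangentSpace 𝓘(ℝ, E) x :=
  tangentPart f x (J (f x) (mfderiv 𝓘(ℝ, E) 𝓘(ℝ, F) f x v))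

/-- A smooth local orthonormal frame `n 1, …, n r` of the normal bundle of the submanifold, over
the open set `dom`. -/
structure NormalFrame (f : M → N) (r : ℕ) where
  dom : Set M
  isOpen_dom : IsOpen dom
  n : Fin r → Π x : M, TangentSpace 𝓘(ℝ, F) (f x)
  smooth : ∀ α, ContMDiffOn 𝓘(ℝ, E) 𝓘(ℝ, F).tangent ∞
    (fun x ↦ (⟨f x, n α x⟩ : TangentBundle 𝓘(ℝ, F) N)) dom
  orthonormal : ∀ x ∈ dom, Orthonormal ℝ (fun α ↦ n α x)
  span_eq : ∀ x ∈ dom,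
    Submodule.span ℝ (Set.range fun α ↦ n α x) = (tangentRange (E := E) f x)ᗮ

/-- The 1-forms `u_α`: the coefficients in `JX = TX + ∑ α, u_α(X) n_α`, that is
`u_α(X) = ḡ(JX, n_α)`. -/
def uForm (J : Π y : N, TangentSpace 𝓘(ℝ, F) y →L[ℝ] TangentSpace 𝓘(ℝ, F) y)
    {f : M → N} {r : ℕ} (Φ : NormalFrame (E := E) (F := F) f r) (α : Fin r) (x : M)
    (v : TangentSpace 𝓘(ℝ, E) x) : ℝ :=
  inner ℝ (J (f x) (mfderiv 𝓘(ℝ, E) 𝓘(ℝ, F) f x v)) (Φ.n α x)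

/-- The covariant derivative `(∇_X u)(Y) = X(u(Y)) - u(∇_X Y)` of a 1-form `u` on `M`, at `x`. -/
def covDerivForm (nab : CovariantDerivative 𝓘(ℝ, E) E (fun x : M ↦ TangentSpace 𝓘(ℝ, E) x))
    (u : Π x : M, TangentSpace 𝓘(ℝ, E) x → ℝ) (X Y : Π x : M, TangentSpace 𝓘(ℝ, E) x)
    (x : M) : ℝ :=
  mvfderiv 𝓘(ℝ, E) (fun y ↦ u y (Y y)) x (X x) - u x (nab Y x (X x))

/-- The covariant derivative `∇̄_v V` at `x` of a vector field `V` along `f`, for `v ∈ T_x M`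
(the pullback connection). In the local frame `s_j` of `TN` given by the trivialization around
`f x`, write `V = ∑ j, V_j s_j`; then
`∇̄_v V = ∑ j, dV_j(v) s_j + ∑ j, V_j(x) ∇̄_{f_* v} s_j`. -/
def covDerivAlong (nab : CovariantDerivative 𝓘(ℝ, F) F (fun y : N ↦ TangentSpace 𝓘(ℝ, F) y))
    (f : M → N) (V : Π x : M, TangentSpace 𝓘(ℝ, F) (f x)) (x : M)
    (v : TangentSpace 𝓘(ℝ, E) x) : TangentSpace 𝓘(ℝ, F) (f x) :=
  let e := trivializationAt F (fun y : N ↦ TangentSpace 𝓘(ℝ, F) y) (f x)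
  e.symm (f x) (mvfderiv 𝓘(ℝ, E) (fun z ↦ (e ⟨f z, V z⟩).2) x v)
    + nab (FiberBundle.extend F (V x)) (f x) (mfderiv 𝓘(ℝ, E) 𝓘(ℝ, F) f x v)

/-- The shape operators `A_α = A_{n_α}`, by the Weingarten formula
`∇̄_X n_α = -A_α X + ∇^⊥_X n_α`. -/
def shapeOp (nab : CovariantDerivative 𝓘(ℝ, F) F (fun y : N ↦ TangentSpace 𝓘(ℝ, F) y))
    {f : M → N} {r : ℕ} (Φ : NormalFrame (E := E) (F := F) f r) (α : Fin r) (x : M)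
    (v : TangentSpace 𝓘(ℝ, E) x) : TangentSpace 𝓘(ℝ, E) x :=
  -tangentPart f x (covDerivAlong nab f (Φ.n α) x v)

/-- `D` is a slant distribution with slant angle `θ`: for all `x` and nonzero `X ∈ D_x`, the angle
between `JX` and the subspace `D_x`, i.e. between `JX` and its orthogonal projection
`P_D (TX)` on `D_x`, equals `θ`. (If that projection vanishes, the angle is `π / 2`.) -/
def IsSlant (J : Π y : N, TangentSpace 𝓘(ℝ, F) y →L[ℝ] TangentSpace 𝓘(ℝ, F) y)
    (f : M → N) (D : Π x : M, Submodule ℝ (TangentSpace 𝓘(ℝ, E) x)) (θ : ℝ) : Prop :=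
  ∀ (x : M), ∀ v ∈ D x, v ≠ 0 →
    InnerProductGeometry.angle (J (f x) (mfderiv 𝓘(ℝ, E) 𝓘(ℝ, F) f x v))
      (mfderiv 𝓘(ℝ, E) 𝓘(ℝ, F) f x ((D x).starProjection (tangT J f x v))) = θ

/-- The submanifold is semi-slant with respect to the distributions `D₁` (invariant) and `D₂`
(slant with angle `θ ≠ 0`). -/
structure IsSemiSlant (J : Π y : N, TangentSpace 𝓘(ℝ, F) y →L[ℝ] TangentSpace 𝓘(ℝ, F) y)
    (f : M → N) (D₁ D₂ : Π x : M, Submodule ℝ (TangentSpace 𝓘(ℝ, E) x)) : Prop where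
  distribution₁ : ∃ k, IsDistribution k D₁
  distribution₂ : ∃ k, IsDistribution k D₂
  orthogonal : ∀ x, D₁ x ⟂ D₂ x
  sup_eq_top : ∀ x, D₁ x ⊔ D₂ x = ⊤
  invariant : ∀ x, ((D₁ x).map (mfderiv 𝓘(ℝ, E) 𝓘(ℝ, F) f x).toLinearMap).map
    (J (f x)).toLinearMap = (D₁ x).map (mfderiv 𝓘(ℝ, E) 𝓘(ℝ, F) f x).toLinearMap
  slant : ∃ θ : ℝ, θ ≠ 0 ∧ IsSlant J f D₂ θ

end Immersion

end

end SemiSlant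

/-!
The proof rests on two pointwise facts about a semi-slant submanifold `f : M → N`.

* `IsSemiSlant.mem_iff_uForm_eq_zero`: `w ∈ D₁` if and only if all `u_α(w)` vanish. Indeed `J` maps
  `D₁` to itself; conversely, if `Jw` is tangent, so is the image `Jb` of the `D₂`-component `b` of
  `w`; it lies in `D₂` because `J` is symmetric and preserves `D₁`, and the slant angle would be
  zero unless `b = 0`.
* `IsSemiSlant.starProjection_tangT_eq_zero_iff`: `w ∈ D₂` if and only if `P₁ (Tw) = 0`, since `T` is
  symmetric and maps `D₁` onto itself.

Both are applied to `w = [X, Y]`. For sections `X, Y` of `D₁` the functions `u_α(X)`, `u_α(Y)` are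
zero, and `∇` is torsion-free, so `(∇_Y u_α)(X) - (∇_X u_α)(Y) = u_α([X, Y])`. For arbitrary `X, Y`,
`tangT_mlieBracket` gives
`T[X, Y] = ∇_X TY - ∇_Y TX - ∑ α, (u_α(Y) A_α X - u_α(X) A_α Y)`.

The last formula is the tangential part of `J (∇̄_X Y - ∇̄_Y X) = ∇̄_X (JY) - ∇̄_Y (JX)`, in which
`JY = TY + ∑ α, u_α(Y) n_α` is differentiated along `f`. This takes some theory of the pullback
connection `covDerivAlong`: it satisfies the Leibniz rule, commutes with the parallel tensor `J`, and
is metric and torsion-free. The Leibniz rule follows from the definition in a trivialization. The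
chain rule, parallelism and the metric property are reduced to the ambient connection by
`MDiffAlongAt.induction`, since a field along `f` is locally a combination of restrictions of ambient
fields whose coefficients are functions on `M`. The torsion is computed in charts, from the symmetry
of second derivatives. The Koszul argument then identifies the tangential part of `∇̄` with `∇`
(`tangentPart_covDerivAlong_mfderiv`). As `∇` is only controlled on differentiable fields, `TY` has
to be shown differentiable, for which `mdifferentiableAt_of_mdiffAlongAt_mfderiv` inverts the
differential of the immersion in charts.
-/

set_option linter.unusedSectionVars false

namespace SemiSlant

open Filter
open scoped Topology

/-! ### Differentiable vector fields along a map -/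

section FieldsAlong

variable {E : Type*} [NormedAddCommGroup E] [NormedSpace ℝ E]
  {M : Type*} [TopologicalSpace M] [ChartedSpace E M]
  {F : Type*} [NormedAddCommGroup F] [NormedSpace ℝ F]
  {N : Type*} [TopologicalSpace N] [ChartedSpace F N] [IsManifold 𝓘(ℝ, F) ∞ N]

/-- The vector field `V` along `f` is differentiable at `x`, as a map into the tangent bundle. -/
def MDiffAlongAt (f : M → N) (V : Π x : M, TangentSpace 𝓘(ℝ, F) (f x)) (x : M) : Prop :=
  MDifferentiableAt 𝓘(ℝ, E) 𝓘(ℝ, F).tangent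
    (fun z ↦ (⟨f z, V z⟩ : TangentBundle 𝓘(ℝ, F) N)) x

variable {f : M → N} {V W : Π x : M, TangentSpace 𝓘(ℝ, F) (f x)} {x : M}

/-- Differentiability along `f`, tested in the trivialization of the tangent bundle around `f x`. -/
theorem mdiffAlongAt_iff (hf : MDifferentiableAt 𝓘(ℝ, E) 𝓘(ℝ, F) f x) :
    MDiffAlongAt (E := E) f V x ↔ MDifferentiableAt 𝓘(ℝ, E) 𝓘(ℝ, F)
      (fun z ↦ (trivializationAt F (fun y : N ↦ TangentSpace 𝓘(ℝ, F) y) (f x) ⟨f z, V z⟩).2) x :=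
  (mdifferentiableAt_totalSpace 𝓘(ℝ, F)
    (fun z ↦ (⟨f z, V z⟩ : TangentBundle 𝓘(ℝ, F) N))).trans (and_iff_right hf)

theorem eventually_mem_baseSet (hf : ContinuousAt f x) :
    ∀ᶠ z in 𝓝 x, f z ∈
      (trivializationAt F (fun y : N ↦ TangentSpace 𝓘(ℝ, F) y) (f x)).baseSet :=
  hf.eventually ((trivializationAt F (fun y : N ↦ TangentSpace 𝓘(ℝ, F) y) (f x)).open_baseSet.mem_nhds
    (FiberBundle.mem_baseSet_trivializationAt' (f x)))

theorem trivializationAt_snd_add {y₀ y : N}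
    (hy : y ∈ (trivializationAt F (fun y : N ↦ TangentSpace 𝓘(ℝ, F) y) y₀).baseSet)
    (v w : TangentSpace 𝓘(ℝ, F) y) :
    (trivializationAt F (fun y : N ↦ TangentSpace 𝓘(ℝ, F) y) y₀ ⟨y, v + w⟩).2 =
      (trivializationAt F (fun y : N ↦ TangentSpace 𝓘(ℝ, F) y) y₀ ⟨y, v⟩).2 +
      (trivializationAt F (fun y : N ↦ TangentSpace 𝓘(ℝ, F) y) y₀ ⟨y, w⟩).2 :=
  ((trivializationAt F (fun y : N ↦ TangentSpace 𝓘(ℝ, F) y) y₀).linear ℝ hy).map_add v w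

theorem trivializationAt_snd_smul {y₀ y : N}
    (hy : y ∈ (trivializationAt F (fun y : N ↦ TangentSpace 𝓘(ℝ, F) y) y₀).baseSet)
    (c : ℝ) (v : TangentSpace 𝓘(ℝ, F) y) :
    (trivializationAt F (fun y : N ↦ TangentSpace 𝓘(ℝ, F) y) y₀ ⟨y, c • v⟩).2 =
      c • (trivializationAt F (fun y : N ↦ TangentSpace 𝓘(ℝ, F) y) y₀ ⟨y, v⟩).2 :=
  ((trivializationAt F (fun y : N ↦ TangentSpace 𝓘(ℝ, F) y) y₀).linear ℝ hy).map_smul c v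

theorem MDiffAlongAt.congr (h : MDiffAlongAt (E := E) f V x) (hVW : ∀ᶠ z in 𝓝 x, V z = W z) :
    MDiffAlongAt (E := E) f W x := by
  refine MDifferentiableAt.congr_of_eventuallyEq h ?_
  filter_upwards [hVW] with z hz
  rw [hz]

theorem MDiffAlongAt.add (hf : MDifferentiableAt 𝓘(ℝ, E) 𝓘(ℝ, F) f x)
    (hV : MDiffAlongAt (E := E) f V x) (hW : MDiffAlongAt (E := E) f W x) :
    MDiffAlongAt (E := E) f (fun z ↦ V z + W z) x := by
  rw [mdiffAlongAt_iff hf] at hV hW ⊢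
  refine (MDifferentiableAt.add hV hW).congr_of_eventuallyEq ?_
  filter_upwards [eventually_mem_baseSet (F := F) hf.continuousAt] with z hz
  exact trivializationAt_snd_add hz _ _

theorem MDiffAlongAt.smul (hf : MDifferentiableAt 𝓘(ℝ, E) 𝓘(ℝ, F) f x) {c : M → ℝ}
    (hc : MDifferentiableAt 𝓘(ℝ, E) 𝓘(ℝ) c x) (hV : MDiffAlongAt (E := E) f V x) :
    MDiffAlongAt (E := E) f (fun z ↦ c z • V z) x := by
  rw [mdiffAlongAt_iff hf] at hV ⊢
  refine (hc.smul hV).congr_of_eventuallyEq ?_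
  filter_upwards [eventually_mem_baseSet (F := F) hf.continuousAt] with z hz
  exact trivializationAt_snd_smul hz _ _

theorem MDiffAlongAt.comp (hf : MDifferentiableAt 𝓘(ℝ, E) 𝓘(ℝ, F) f x)
    {σ : Π y : N, TangentSpace 𝓘(ℝ, F) y}
    (hσ : MDifferentiableAt 𝓘(ℝ, F) 𝓘(ℝ, F).tangent
      (fun y ↦ (⟨y, σ y⟩ : TangentBundle 𝓘(ℝ, F) N)) (f x)) :
    MDiffAlongAt (E := E) f (fun z ↦ σ (f z)) x :=
  MDifferentiableAt.comp (I' := 𝓘(ℝ, F)) x hσ hf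

/-- Every differentiable field along `f` is near `x` a combination `∑ j, c_j (s_j ∘ f)` of
restrictions of fields of the ambient manifold. Hence a property of fields along `f` that is local,
compatible with sums and with multiplication by functions holds for all of them once it holds for
restrictions of ambient fields. -/
theorem MDiffAlongAt.induction [FiniteDimensional ℝ F]
    {P : (Π x : M, TangentSpace 𝓘(ℝ, F) (f x)) → Prop}
    (hf : MDifferentiableAt 𝓘(ℝ, E) 𝓘(ℝ, F) f x)
    (congr : ∀ V W, MDiffAlongAt (E := E) f V x → P V → (∀ᶠ z in 𝓝 x, V z = W z) → P W)
    (add : ∀ V W, MDiffAlongAt (E := E) f V x → P V → MDiffAlongAt (E := E) f W x → P W →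
      P (fun z ↦ V z + W z))
    (smul : ∀ (c : M → ℝ) V, MDifferentiableAt 𝓘(ℝ, E) 𝓘(ℝ) c x →
      MDiffAlongAt (E := E) f V x → P V → P (fun z ↦ c z • V z))
    (extend : ∀ a : TangentSpace 𝓘(ℝ, F) (f x), P (fun z ↦ FiberBundle.extend F a (f z)))
    (hV : MDiffAlongAt (E := E) f V x) : P V := by
  let e := trivializationAt F (fun y : N ↦ TangentSpace 𝓘(ℝ, F) y) (f x)
  let b := Module.finBasis ℝ F
  let s (j) : Π y : N, TangentSpace 𝓘(ℝ, F) y :=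
    FiberBundle.extend F (x := f x) (e.symm (f x) (b j))
  let c (j) (z : M) : ℝ := b.coord j (e ⟨f z, V z⟩).2
  have hs (j) : MDifferentiableAt 𝓘(ℝ, F) 𝓘(ℝ, F).tangent
      (fun y ↦ (⟨y, s j y⟩ : TangentBundle 𝓘(ℝ, F) N)) (f x) :=
    FiberBundle.mdifferentiableAt_extend _ _ _
  have hc (j) : MDifferentiableAt 𝓘(ℝ, E) 𝓘(ℝ) (c j) x :=
    ((LinearMap.toContinuousLinearMap (b.coord j)).mdifferentiableAt).comp x
      ((mdiffAlongAt_iff hf).1 hV)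
  have key (t : Finset (Fin (Module.finrank ℝ F))) :
      MDiffAlongAt (E := E) f (fun z ↦ ∑ j ∈ t, c j z • s j (f z)) x ∧
        P (fun z ↦ ∑ j ∈ t, c j z • s j (f z)) := by
    induction t using Finset.induction_on with
    | empty =>
      have h0 := MDiffAlongAt.comp hf (FiberBundle.mdifferentiableAt_extend 𝓘(ℝ, F) F
        (0 : TangentSpace 𝓘(ℝ, F) (f x)))
      have h1 := MDiffAlongAt.smul hf (c := fun _ ↦ 0) mdifferentiableAt_const h0
      have h2 := smul (fun _ ↦ 0) _ mdifferentiableAt_const h0 (extend 0)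
      simp only [zero_smul] at h1 h2
      simpa using ⟨h1, h2⟩
    | insert j t hj ih =>
      simp only [Finset.sum_insert hj]
      have h1 := MDiffAlongAt.comp hf (hs j)
      have h2 := MDiffAlongAt.smul hf (hc j) h1
      exact ⟨MDiffAlongAt.add hf h2 ih.1, add _ _ h2 (smul _ _ (hc j) h1 (extend _)) ih.1 ih.2⟩
  refine congr _ _ (key Finset.univ).1 (key Finset.univ).2 ?_
  filter_upwards [eventually_mem_baseSet (F := F) hf.continuousAt] with z hz
  have hxs := FiberBundle.mem_baseSet_trivializationAt' (F := F)
    (E := fun y : N ↦ TangentSpace 𝓘(ℝ, F) y) (f x)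
  have hsz (j) : s j (f z) = e.symmL ℝ (f z) (b j) := by
    simp only [s, FiberBundle.extend]
    rw [e.symmL_apply hz, e.mk_symm hxs, e.apply_symm_apply' hxs]
  simp only [hsz, ← map_smul, ← map_sum, c, b.coord_apply, b.sum_repr]
  rw [e.symmL_apply hz]
  exact e.symm_apply_apply_mk hz _

end FieldsAlong

/-! ### The pullback connection -/

section CovDerivAlong

variable {E : Type*} [NormedAddCommGroup E] [NormedSpace ℝ E]
  {M : Type*} [TopologicalSpace M] [ChartedSpace E M]
  {F : Type*} [NormedAddCommGroup F] [NormedSpace ℝ F]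
  {N : Type*} [TopologicalSpace N] [ChartedSpace F N] [IsManifold 𝓘(ℝ, F) ∞ N]
  (nab : CovariantDerivative 𝓘(ℝ, F) F (fun y : N ↦ TangentSpace 𝓘(ℝ, F) y))
  {f : M → N} {V W : Π x : M, TangentSpace 𝓘(ℝ, F) (f x)} {x : M}

theorem eventually_extend_eq_symmL {y : N} (a : TangentSpace 𝓘(ℝ, F) y) :
    ∀ᶠ z in 𝓝 y, FiberBundle.extend F a z =
      (trivializationAt F (fun y : N ↦ TangentSpace 𝓘(ℝ, F) y) y).symmL ℝ z
        (trivializationAt F (fun y : N ↦ TangentSpace 𝓘(ℝ, F) y) y ⟨y, a⟩).2 := by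
  filter_upwards [eventually_mem_baseSet (f := id) (x := y) (F := F) continuousAt_id] with z hz
  exact (Trivialization.symmL_apply _ hz _).symm

theorem eventually_trivializationAt_extend {y : N} (a : TangentSpace 𝓘(ℝ, F) y) :
    ∀ᶠ z in 𝓝 y, (trivializationAt F (fun y : N ↦ TangentSpace 𝓘(ℝ, F) y) y
        ⟨z, FiberBundle.extend F a z⟩).2 =
      (trivializationAt F (fun y : N ↦ TangentSpace 𝓘(ℝ, F) y) y ⟨y, a⟩).2 := by
  filter_upwards [eventually_mem_baseSet (f := id) (x := y) (F := F) continuousAt_id] with z hz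
  have h := Trivialization.apply_mk_symm
    (trivializationAt F (fun y : N ↦ TangentSpace 𝓘(ℝ, F) y) y) hz
    (trivializationAt F (fun y : N ↦ TangentSpace 𝓘(ℝ, F) y) y ⟨y, a⟩).2
  exact congr($(h).2)

theorem nab_extend_add {y : N} (a b : TangentSpace 𝓘(ℝ, F) y) :
    nab (FiberBundle.extend F (a + b)) y =
      nab (FiberBundle.extend F a) y + nab (FiberBundle.extend F b) y := by
  rw [← nab.isCovariantDerivativeOnUniv.add (FiberBundle.mdifferentiableAt_extend ..)
    (FiberBundle.mdifferentiableAt_extend ..)]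
  refine nab.isCovariantDerivativeOnUniv.congr_of_eventuallyEq
    (FiberBundle.mdifferentiableAt_extend ..) (mdifferentiableAt_add_section
      (FiberBundle.mdifferentiableAt_extend ..) (FiberBundle.mdifferentiableAt_extend ..))
    univ_mem ?_
  filter_upwards [eventually_extend_eq_symmL a, eventually_extend_eq_symmL b,
    eventually_extend_eq_symmL (a + b)] with z ha hb hab
  rw [Pi.add_apply, ha, hb, hab, ← map_add, trivializationAt_snd_add
    (FiberBundle.mem_baseSet_trivializationAt' y)]

theorem nab_extend_smul {y : N} (c : ℝ) (a : TangentSpace 𝓘(ℝ, F) y) :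
    nab (FiberBundle.extend F (c • a)) y = c • nab (FiberBundle.extend F a) y := by
  rw [← nab.isCovariantDerivativeOnUniv.smul_const c (FiberBundle.mdifferentiableAt_extend ..)]
  refine nab.isCovariantDerivativeOnUniv.congr_of_eventuallyEq
    (FiberBundle.mdifferentiableAt_extend ..) (MDifferentiableAt.smul_section mdifferentiableAt_const
      (FiberBundle.mdifferentiableAt_extend ..)) univ_mem ?_
  filter_upwards [eventually_extend_eq_symmL a, eventually_extend_eq_symmL (c • a)] with z ha hb
  rw [Pi.smul_apply, ha, hb, ← map_smul, trivializationAt_snd_smul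
    (FiberBundle.mem_baseSet_trivializationAt' y)]

theorem covDerivAlong_eq (v : TangentSpace 𝓘(ℝ, E) x) :
    covDerivAlong nab f V x v =
      (trivializationAt F (fun y : N ↦ TangentSpace 𝓘(ℝ, F) y) (f x)).symmL ℝ (f x)
        (mvfderiv 𝓘(ℝ, E) (fun z ↦
          (trivializationAt F (fun y : N ↦ TangentSpace 𝓘(ℝ, F) y) (f x) ⟨f z, V z⟩).2) x v)
      + nab (FiberBundle.extend F (V x)) (f x) (mfderiv 𝓘(ℝ, E) 𝓘(ℝ, F) f x v) := by
  rw [Trivialization.symmL_apply _ (FiberBundle.mem_baseSet_trivializationAt' (f x))]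
  rfl

theorem mvfderiv_congr {G : Type*} [NormedAddCommGroup G] [NormedSpace ℝ G] {g h : M → G}
    (hgh : g =ᶠ[𝓝 x] h) : mvfderiv 𝓘(ℝ, E) g x = mvfderiv 𝓘(ℝ, E) h x := by
  ext v
  change mfderiv 𝓘(ℝ, E) 𝓘(ℝ, G) g x v = mfderiv 𝓘(ℝ, E) 𝓘(ℝ, G) h x v
  rw [hgh.mfderiv_eq]
  rfl

theorem covDerivAlong_congr (hVW : ∀ᶠ z in 𝓝 x, V z = W z) (v : TangentSpace 𝓘(ℝ, E) x) :
    covDerivAlong nab f V x v = covDerivAlong nab f W x v := by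
  rw [covDerivAlong_eq, covDerivAlong_eq, hVW.self_of_nhds]
  congr 3
  apply mvfderiv_congr
  filter_upwards [hVW] with z hz
  rw [hz]

theorem covDerivAlong_add (hf : MDifferentiableAt 𝓘(ℝ, E) 𝓘(ℝ, F) f x)
    (hV : MDiffAlongAt (E := E) f V x) (hW : MDiffAlongAt (E := E) f W x)
    (v : TangentSpace 𝓘(ℝ, E) x) :
    covDerivAlong nab f (fun z ↦ V z + W z) x v =
      covDerivAlong nab f V x v + covDerivAlong nab f W x v := by
  rw [mdiffAlongAt_iff hf] at hV hW
  have h := mvfderiv_congr (E := E) (x := x) (g := fun z ↦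
      (trivializationAt F (fun y : N ↦ TangentSpace 𝓘(ℝ, F) y) (f x) ⟨f z, V z + W z⟩).2)
    ((eventually_mem_baseSet (F := F) hf.continuousAt).mono fun z hz ↦
      trivializationAt_snd_add hz _ _)
  simp only [covDerivAlong_eq, nab_extend_add]
  rw [h, mvfderiv_fun_add hV hW]
  simp only [add_apply, map_add]
  abel

/-- The Leibniz rule for the pullback connection. -/
theorem covDerivAlong_smul (hf : MDifferentiableAt 𝓘(ℝ, E) 𝓘(ℝ, F) f x) {c : M → ℝ}
    (hc : MDifferentiableAt 𝓘(ℝ, E) 𝓘(ℝ) c x) (hV : MDiffAlongAt (E := E) f V x)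
    (v : TangentSpace 𝓘(ℝ, E) x) :
    covDerivAlong nab f (fun z ↦ c z • V z) x v =
      mvfderiv 𝓘(ℝ, E) c x v • V x + c x • covDerivAlong nab f V x v := by
  rw [mdiffAlongAt_iff hf] at hV
  have h := mvfderiv_congr (E := E) (x := x) (g := fun z ↦
      (trivializationAt F (fun y : N ↦ TangentSpace 𝓘(ℝ, F) y) (f x) ⟨f z, c z • V z⟩).2)
    ((eventually_mem_baseSet (F := F) hf.continuousAt).mono fun z hz ↦
      trivializationAt_snd_smul hz _ _)
  have hx := FiberBundle.mem_baseSet_trivializationAt' (F := F)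
    (E := fun y : N ↦ TangentSpace 𝓘(ℝ, F) y) (f x)
  have hxV : (trivializationAt F (fun y : N ↦ TangentSpace 𝓘(ℝ, F) y) (f x)).symmL ℝ (f x)
      (trivializationAt F (fun y : N ↦ TangentSpace 𝓘(ℝ, F) y) (f x) ⟨f x, V x⟩).2 = V x := by
    rw [Trivialization.symmL_apply _ hx]
    exact Trivialization.symm_apply_apply_mk _ hx _
  simp only [covDerivAlong_eq, nab_extend_smul]
  rw [h, mvfderiv_fun_smul hc hV]
  simp only [add_apply, smul_apply,
    ContinuousLinearMap.smulRight_apply, map_add, map_smul, hxV, smul_add]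
  abel

theorem MDiffAlongAt.sum {ι : Type*} (s : Finset ι) {V : ι → Π x : M, TangentSpace 𝓘(ℝ, F) (f x)}
    (hf : MDifferentiableAt 𝓘(ℝ, E) 𝓘(ℝ, F) f x) (hV : ∀ i, MDiffAlongAt (E := E) f (V i) x) :
    MDiffAlongAt (E := E) f (fun z ↦ ∑ i ∈ s, V i z) x := by
  induction s using Finset.cons_induction with
  | empty =>
    have h := MDiffAlongAt.smul hf (c := fun _ ↦ 0) mdifferentiableAt_const
      (MDiffAlongAt.comp hf (FiberBundle.mdifferentiableAt_extend 𝓘(ℝ, F) F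
        (0 : TangentSpace 𝓘(ℝ, F) (f x))))
    simpa using h
  | cons i s hi ih =>
    simp only [Finset.sum_cons]
    exact MDiffAlongAt.add hf (hV i) ih

theorem covDerivAlong_sum {ι : Type*} (s : Finset ι)
    {V : ι → Π x : M, TangentSpace 𝓘(ℝ, F) (f x)} (hf : MDifferentiableAt 𝓘(ℝ, E) 𝓘(ℝ, F) f x)
    (hV : ∀ i, MDiffAlongAt (E := E) f (V i) x) (v : TangentSpace 𝓘(ℝ, E) x) :
    covDerivAlong nab f (fun z ↦ ∑ i ∈ s, V i z) x v =
      ∑ i ∈ s, covDerivAlong nab f (V i) x v := by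
  induction s using Finset.cons_induction with
  | empty =>
    have h := covDerivAlong_smul nab hf (c := fun _ ↦ 0) mdifferentiableAt_const
      (MDiffAlongAt.sum ∅ hf hV) v
    simpa using h
  | cons i s hi ih =>
    simp only [Finset.sum_cons]
    rw [covDerivAlong_add nab hf (hV i) (MDiffAlongAt.sum s hf hV), ih]

/-- A connection written in the frame of the trivialization around `y`. -/
theorem nab_eq [FiniteDimensional ℝ F] {y : N} {σ : Π y : N, TangentSpace 𝓘(ℝ, F) y}
    (hσ : MDifferentiableAt 𝓘(ℝ, F) 𝓘(ℝ, F).tangent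
      (fun y ↦ (⟨y, σ y⟩ : TangentBundle 𝓘(ℝ, F) N)) y) (u : TangentSpace 𝓘(ℝ, F) y) :
    nab σ y u = (trivializationAt F (fun y : N ↦ TangentSpace 𝓘(ℝ, F) y) y).symmL ℝ y
        (mvfderiv 𝓘(ℝ, F) (fun z ↦
          (trivializationAt F (fun y : N ↦ TangentSpace 𝓘(ℝ, F) y) y ⟨z, σ z⟩).2) y u)
      + nab (FiberBundle.extend F (σ y)) y u := by
  have hu : covDerivAlong nab id σ y u = _ := covDerivAlong_eq nab u
  simp only [mfderiv_id] at hu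
  refine Eq.trans ?_ hu
  have hid : MDifferentiableAt 𝓘(ℝ, F) 𝓘(ℝ, F) (id : N → N) y := mdifferentiableAt_id
  have hnab := nab.isCovariantDerivativeOnUniv
  refine MDiffAlongAt.induction (E := F) (F := F) (M := N) (f := id)
    (P := fun τ ↦ nab τ y u = covDerivAlong nab id τ y u) hid ?_ ?_ ?_ ?_ hσ
  · intro V W hV h hVW
    rw [← covDerivAlong_congr nab hVW, ← h]
    exact congr($((hnab.congr_of_eventuallyEq hV (hV.congr hVW) univ_mem hVW).symm) u)
  · intro V W hV h hW h'
    rw [covDerivAlong_add nab hid hV hW, ← h, ← h']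
    exact congr($(hnab.add hV hW) u)
  · intro c V hc hV h
    rw [covDerivAlong_smul nab hid hc hV, ← h]
    refine (congr($(hnab.leibniz hV hc) u)).trans ?_
    simp [add_comm]
  · intro a
    rw [covDerivAlong_eq]
    have h := mvfderiv_congr (E := F) (M := N) (x := y)
      (eventually_trivializationAt_extend (y := y) a)
    rw [mvfderiv_const] at h
    simp only [id] at h ⊢
    rw [h, mfderiv_id]
    simp

/-- The chain rule for the pullback connection. -/
theorem covDerivAlong_comp [FiniteDimensional ℝ F] (hf : MDifferentiableAt 𝓘(ℝ, E) 𝓘(ℝ, F) f x)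
    {σ : Π y : N, TangentSpace 𝓘(ℝ, F) y}
    (hσ : MDifferentiableAt 𝓘(ℝ, F) 𝓘(ℝ, F).tangent
      (fun y ↦ (⟨y, σ y⟩ : TangentBundle 𝓘(ℝ, F) N)) (f x)) (v : TangentSpace 𝓘(ℝ, E) x) :
    covDerivAlong nab f (fun z ↦ σ (f z)) x v =
      nab σ (f x) (mfderiv 𝓘(ℝ, E) 𝓘(ℝ, F) f x v) := by
  rw [covDerivAlong_eq, nab_eq nab hσ]
  congr 2
  exact mfderiv_comp_apply (I' := 𝓘(ℝ, F)) x
    ((mdifferentiableAt_section _ σ).1 hσ) hf v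

end CovDerivAlong

/-! ### Parallelism and metric compatibility of the pullback connection -/

section Parallel

variable {E : Type*} [NormedAddCommGroup E] [NormedSpace ℝ E]
  {M : Type*} [TopologicalSpace M] [ChartedSpace E M]
  {F : Type*} [NormedAddCommGroup F] [NormedSpace ℝ F] [FiniteDimensional ℝ F]
  {N : Type*} [TopologicalSpace N] [ChartedSpace F N] [IsManifold 𝓘(ℝ, F) ∞ N]
  [RiemannianBundle (fun y : N ↦ TangentSpace 𝓘(ℝ, F) y)]
  {nab : CovariantDerivative 𝓘(ℝ, F) F (fun y : N ↦ TangentSpace 𝓘(ℝ, F) y)}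
  {J : Π y : N, TangentSpace 𝓘(ℝ, F) y →L[ℝ] TangentSpace 𝓘(ℝ, F) y} {p q : ℕ}
  {f : M → N} {V W : Π x : M, TangentSpace 𝓘(ℝ, F) (f x)} {x : M}

theorem IsMetallicRiemannian.mdiffAlongAt (hJ : IsMetallicRiemannian p q J)
    (hf : MDifferentiableAt 𝓘(ℝ, E) 𝓘(ℝ, F) f x) (hV : MDiffAlongAt (E := E) f V x) :
    MDiffAlongAt (E := E) f (fun z ↦ J (f z) (V z)) x :=
  MDifferentiableAt.clm_bundle_apply (b := f) (ϕ := fun z ↦ J (f z))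
    (MDifferentiableAt.comp x (hJ.smooth.mdifferentiable (by simp) (f x)) hf) hV

/-- A parallel structure on the ambient manifold commutes with the pullback connection. -/
theorem IsLocallyMetallic.covDerivAlong_eq (hJ : IsLocallyMetallic p q J nab)
    (hf : MDifferentiableAt 𝓘(ℝ, E) 𝓘(ℝ, F) f x) (hV : MDiffAlongAt (E := E) f V x)
    (v : TangentSpace 𝓘(ℝ, E) x) :
    covDerivAlong nab f (fun z ↦ J (f z) (V z)) x v = J (f x) (covDerivAlong nab f V x v) := by
  have hJd {V : Π x : M, TangentSpace 𝓘(ℝ, F) (f x)} (hV : MDiffAlongAt (E := E) f V x) :=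
    hJ.metallic.mdiffAlongAt hf hV
  refine MDiffAlongAt.induction (P := fun V ↦ covDerivAlong nab f (fun z ↦ J (f z) (V z)) x v =
    J (f x) (covDerivAlong nab f V x v)) hf ?_ ?_ ?_ ?_ hV
  · intro V W hV h hVW
    rw [← covDerivAlong_congr nab hVW, ← h]
    refine (covDerivAlong_congr nab ?_ v).symm
    filter_upwards [hVW] with z hz
    rw [hz]
  · intro V W hV h hW h'
    simp only [map_add]
    rw [covDerivAlong_add nab hf hV hW, covDerivAlong_add nab hf (hJd hV) (hJd hW), h, h', map_add]
  · intro c V hc hV h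
    simp only [map_smul]
    rw [covDerivAlong_smul nab hf hc hV, covDerivAlong_smul nab hf hc (hJd hV), h, map_add,
      map_smul, map_smul]
  · intro a
    have ha := FiberBundle.mdifferentiableAt_extend 𝓘(ℝ, F) F a
    rw [covDerivAlong_comp nab hf ha, ← hJ.parallel _ _ ha]
    refine covDerivAlong_comp nab hf (σ := fun y ↦ J y (FiberBundle.extend F a y)) ?_ v
    exact hJ.metallic.mdiffAlongAt (E := F) (f := id) mdifferentiableAt_id ha

variable [IsContMDiffRiemannianBundle 𝓘(ℝ, F) ∞ F (fun y : N ↦ TangentSpace 𝓘(ℝ, F) y)]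

theorem MDiffAlongAt.inner (hV : MDiffAlongAt (E := E) f V x) (hW : MDiffAlongAt (E := E) f W x) :
    MDifferentiableAt 𝓘(ℝ, E) 𝓘(ℝ) (fun z ↦ inner ℝ (V z) (W z)) x :=
  MDifferentiableAt.inner_bundle (IB := 𝓘(ℝ, F)) (b := f) hV hW

/-- The pullback of the Levi-Civita connection is metric. Both sides are derivations in `V` and in
`W`, which reduces the claim to restrictions of ambient fields. -/
theorem IsLeviCivita.mvfderiv_inner_along (hnab : IsLeviCivita nab)
    (hf : MDifferentiableAt 𝓘(ℝ, E) 𝓘(ℝ, F) f x)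
    (hV : MDiffAlongAt (E := E) f V x) (hW : MDiffAlongAt (E := E) f W x)
    (v : TangentSpace 𝓘(ℝ, E) x) :
    mvfderiv 𝓘(ℝ, E) (fun z ↦ inner ℝ (V z) (W z)) x v =
      inner ℝ (covDerivAlong nab f V x v) (W x) + inner ℝ (V x) (covDerivAlong nab f W x v) := by
  refine MDiffAlongAt.induction
    (P := fun V ↦ mvfderiv 𝓘(ℝ, E) (fun z ↦ inner ℝ (V z) (W z)) x v =
      inner ℝ (covDerivAlong nab f V x v) (W x) + inner ℝ (V x) (covDerivAlong nab f W x v))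
    hf ?_ ?_ ?_ ?_ hV
  · intro V V' hV h hVV'
    rw [← covDerivAlong_congr nab hVV', ← hVV'.self_of_nhds, ← h]
    refine congr($(mvfderiv_congr ?_) v)
    filter_upwards [hVV'] with z hz
    rw [hz]
  · intro V V' hV h hV' h'
    simp only [inner_add_left]
    rw [covDerivAlong_add nab hf hV hV', mvfderiv_fun_add (hV.inner hW) (hV'.inner hW),
      add_apply, h, h', inner_add_left]
    ring
  · intro c V hc hV h
    simp only [inner_smul_left, conj_trivial]
    rw [covDerivAlong_smul nab hf hc hV, mvfderiv_fun_mul hc (hV.inner hW)]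
    simp only [add_apply, smul_apply, h, inner_add_left, inner_smul_left, conj_trivial, smul_eq_mul]
    ring
  intro a
  have ha := FiberBundle.mdifferentiableAt_extend 𝓘(ℝ, F) F a
  have hV := MDiffAlongAt.comp hf ha
  generalize FiberBundle.extend F a = σ at ha hV
  refine MDiffAlongAt.induction
    (P := fun W ↦ mvfderiv 𝓘(ℝ, E) (fun z ↦ inner ℝ (σ (f z)) (W z)) x v =
      inner ℝ (covDerivAlong nab f (fun z ↦ σ (f z)) x v) (W x) +
        inner ℝ (σ (f x)) (covDerivAlong nab f W x v)) hf ?_ ?_ ?_ ?_ hW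
  · intro V V' hV h hVV'
    rw [← covDerivAlong_congr nab hVV', ← hVV'.self_of_nhds, ← h]
    refine congr($(mvfderiv_congr ?_) v)
    filter_upwards [hVV'] with z hz
    rw [hz]
  · intro W W' hW h hW' h'
    simp only [inner_add_right]
    rw [covDerivAlong_add nab hf hW hW', mvfderiv_fun_add (hV.inner hW) (hV.inner hW'),
      add_apply, h, h', inner_add_right]
    ring
  · intro c W hc hW h
    simp only [inner_smul_right]
    rw [covDerivAlong_smul nab hf hc hW, mvfderiv_fun_mul hc (hV.inner hW)]
    simp only [add_apply, smul_apply, h, inner_add_right, inner_smul_right, smul_eq_mul]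
    ring
  · intro b
    have hb := FiberBundle.mdifferentiableAt_extend 𝓘(ℝ, F) F b
    rw [covDerivAlong_comp nab hf ha, covDerivAlong_comp nab hf hb, ← hnab.metric _ _ _ ha hb]
    exact mfderiv_comp_apply (I' := 𝓘(ℝ, F)) x
      (MDiffAlongAt.inner (E := F) (f := id) ha hb) hf v

end Parallel

/-! ### The Lie bracket in a chart -/

section LieBracket

variable {E : Type*} [NormedAddCommGroup E] [NormedSpace ℝ E] [CompleteSpace E]
  {M : Type*} [TopologicalSpace M] [ChartedSpace E M] [IsManifold 𝓘(ℝ, E) ∞ M]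
  {G : Type*} [NormedAddCommGroup G] [NormedSpace ℝ G]
  {X Y : Π x : M, TangentSpace 𝓘(ℝ, E) x} {g : M → G} {x : M}

/-- The vector field `X` read in the chart at `x`, as a map of the model space. It is meaningful on
the target of the chart. -/
noncomputable def fieldInChart (x : M) (X : Π x : M, TangentSpace 𝓘(ℝ, E) x) : E → E :=
  VectorField.mpullbackWithin 𝓘(ℝ, E) 𝓘(ℝ, E) (extChartAt 𝓘(ℝ, E) x).symm X
    (Set.range 𝓘(ℝ, E))

theorem fieldInChart_apply {z : M} (hz : z ∈ (extChartAt 𝓘(ℝ, E) x).source) :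
    fieldInChart x X (extChartAt 𝓘(ℝ, E) x z) =
      mvfderiv 𝓘(ℝ, E) (extChartAt 𝓘(ℝ, E) x) z (X z) := by
  have hz' := (extChartAt 𝓘(ℝ, E) x).map_source hz
  have hinv := isInvertible_mfderivWithin_extChartAt_symm hz'
  have hcomp := mfderivWithin_extChartAt_symm_comp_mfderiv_extChartAt' hz
  apply hinv.injective
  simp only [fieldInChart, VectorField.mpullbackWithin_apply]
  refine (hinv.self_apply_inverse _).trans ?_
  rw [(extChartAt 𝓘(ℝ, E) x).left_inv hz]
  exact congr($hcomp.symm (X z))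

theorem fieldInChart_self : fieldInChart x X (extChartAt 𝓘(ℝ, E) x x) = X x := by
  rw [fieldInChart_apply (mem_extChartAt_source x)]
  exact congr($(mfderiv_extChartAt_self (I := 𝓘(ℝ, E)) (x := x)) (X x))

theorem differentiableAt_fieldInChart (hX : MDifferentiableAt 𝓘(ℝ, E) 𝓘(ℝ, E).tangent
      (fun y ↦ (⟨y, X y⟩ : TangentBundle 𝓘(ℝ, E) M)) x) :
    DifferentiableAt ℝ (fieldInChart x X) (extChartAt 𝓘(ℝ, E) x x) := by
  have := (mdifferentiableWithinAt_univ.2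
    hX).differentiableWithinAt_mpullbackWithin_vectorField
  rw [Set.preimage_univ, Set.univ_inter] at this
  exact this.differentiableAt (by simp)

theorem mlieBracket_eq_fderiv_fieldInChart :
    VectorField.mlieBracket 𝓘(ℝ, E) X Y x =
      (fderiv ℝ (fieldInChart x Y) (extChartAt 𝓘(ℝ, E) x x) (X x) -
        fderiv ℝ (fieldInChart x X) (extChartAt 𝓘(ℝ, E) x x) (Y x) : E) := by
  have hid (w : E) : (mfderiv 𝓘(ℝ, E) 𝓘(ℝ, E) (extChartAt 𝓘(ℝ, E) x) x).inverse w = w := by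
    have h : (ContinuousLinearMap.id ℝ E).inverse w = w := by
      rw [ContinuousLinearMap.inverse_id, ContinuousLinearMap.id_apply]
    rw [mfderiv_extChartAt_self]
    exact h
  rw [VectorField.mlieBracket, VectorField.mlieBracketWithin_apply]
  refine (hid _).trans ?_
  have hbr : VectorField.lieBracket ℝ (fieldInChart x X) (fieldInChart x Y)
      (extChartAt 𝓘(ℝ, E) x x) =
      fderiv ℝ (fieldInChart x Y) (extChartAt 𝓘(ℝ, E) x x)
        (fieldInChart x X (extChartAt 𝓘(ℝ, E) x x)) -
      fderiv ℝ (fieldInChart x X) (extChartAt 𝓘(ℝ, E) x x)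
        (fieldInChart x Y (extChartAt 𝓘(ℝ, E) x x)) := by
    rw [VectorField.lieBracket_eq]
  rw [fieldInChart_self, fieldInChart_self] at hbr
  refine Eq.trans ?_ hbr
  have huniv : (extChartAt 𝓘(ℝ, E) x).symm ⁻¹' Set.univ ∩ Set.range 𝓘(ℝ, E) = Set.univ := by simp
  rw [huniv]
  exact congrFun (VectorField.lieBracketWithin_univ (𝕜 := ℝ) (V := fieldInChart x X)
    (W := fieldInChart x Y)) _

theorem contDiffAt_comp_extChartAt_symm (hg : ContMDiffAt 𝓘(ℝ, E) 𝓘(ℝ, G) ∞ g x) :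
    ContDiffAt ℝ ∞ (g ∘ (extChartAt 𝓘(ℝ, E) x).symm) (extChartAt 𝓘(ℝ, E) x x) := by
  have := (contMDiffAt_iff.1 hg).2
  simpa using! this.contDiffAt (by simp)

theorem eventually_mvfderiv_eq_fderiv (hg : ContMDiffAt 𝓘(ℝ, E) 𝓘(ℝ, G) ∞ g x) :
    ∀ᶠ z in 𝓝 x, mvfderiv 𝓘(ℝ, E) g z (Y z) =
      fderiv ℝ (g ∘ (extChartAt 𝓘(ℝ, E) x).symm) (extChartAt 𝓘(ℝ, E) x z)
        (fieldInChart x Y (extChartAt 𝓘(ℝ, E) x z)) := by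
  have hg' : ∀ᶠ a in 𝓝 (extChartAt 𝓘(ℝ, E) x x),
      DifferentiableAt ℝ (g ∘ (extChartAt 𝓘(ℝ, E) x).symm) a :=
    (((contDiffAt_comp_extChartAt_symm hg).of_le (m := 1) (by simp)).eventually
      (by simp)).mono fun a ha ↦ ha.differentiableAt (by simp)
  filter_upwards [(continuousAt_extChartAt (I := 𝓘(ℝ, E)) x).eventually hg',
    extChartAt_source_mem_nhds (I := 𝓘(ℝ, E)) x] with z hz hzs
  rw [fieldInChart_apply hzs]
  have hφ : MDifferentiableAt 𝓘(ℝ, E) 𝓘(ℝ, E) (extChartAt 𝓘(ℝ, E) x) z :=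
    mdifferentiableAt_extChartAt (by simpa using hzs)
  have h := mfderiv_comp_apply (I'' := 𝓘(ℝ, G)) z hz.mdifferentiableAt hφ (Y z)
  rw [mfderiv_eq_fderiv] at h
  refine Eq.trans ?_ h
  refine congr($(mvfderiv_congr ?_) (Y z))
  filter_upwards [(isOpen_extChartAt_source (I := 𝓘(ℝ, E)) x).mem_nhds hzs] with w hw
  simp only [Function.comp_apply]
  rw [(extChartAt 𝓘(ℝ, E) x).left_inv hw]

theorem mvfderiv_eq_fderiv_chart (hg : ContMDiffAt 𝓘(ℝ, E) 𝓘(ℝ, G) ∞ g x) (w : E) :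
    mvfderiv 𝓘(ℝ, E) g x w =
      fderiv ℝ (g ∘ (extChartAt 𝓘(ℝ, E) x).symm) (extChartAt 𝓘(ℝ, E) x x) w := by
  have h := (hg.mdifferentiableAt (by simp)).mvfderiv
  rw [modelWithCornersSelf_coe, Set.range_id, fderivWithin_univ] at h
  exact congr($h w)

/-- The iterated derivative `v (dg Y)`, by the product rule in the chart. -/
theorem mvfderiv_mvfderiv (hg : ContMDiffAt 𝓘(ℝ, E) 𝓘(ℝ, G) ∞ g x)
    (hY : MDifferentiableAt 𝓘(ℝ, E) 𝓘(ℝ, E).tangent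
      (fun y ↦ (⟨y, Y y⟩ : TangentBundle 𝓘(ℝ, E) M)) x) (v : TangentSpace 𝓘(ℝ, E) x) :
    mvfderiv 𝓘(ℝ, E) (fun z ↦ mvfderiv 𝓘(ℝ, E) g z (Y z)) x v =
      fderiv ℝ (fderiv ℝ (g ∘ (extChartAt 𝓘(ℝ, E) x).symm)) (extChartAt 𝓘(ℝ, E) x x) v (Y x) +
      mvfderiv 𝓘(ℝ, E) g x (fderiv ℝ (fieldInChart x Y) (extChartAt 𝓘(ℝ, E) x x) v) := by
  have hY' := differentiableAt_fieldInChart hY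
  have hg' : DifferentiableAt ℝ (fderiv ℝ (g ∘ (extChartAt 𝓘(ℝ, E) x).symm))
      (extChartAt 𝓘(ℝ, E) x x) :=
    (((contDiffAt_comp_extChartAt_symm hg).of_le (m := 2) ENat.LEInfty.out).fderiv_right (m := 1)
      (by norm_num)).differentiableAt (by simp)
  have hφ : MDifferentiableAt 𝓘(ℝ, E) 𝓘(ℝ, E) (extChartAt 𝓘(ℝ, E) x) x :=
    mdifferentiableAt_extChartAt (by simp)
  have hk := hg'.clm_apply hY'
  rw [mvfderiv_congr (eventually_mvfderiv_eq_fderiv hg)]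
  refine (mfderiv_comp_apply (I' := 𝓘(ℝ, E)) (I'' := 𝓘(ℝ, G)) x hk.mdifferentiableAt hφ v).trans ?_
  rw [mfderiv_eq_fderiv, fderiv_clm_apply hg' hY', mfderiv_extChartAt_self, fieldInChart_self]
  refine Eq.trans ?_ (congrArg₂ (· + ·) rfl (mvfderiv_eq_fderiv_chart hg _).symm)
  exact add_comm _ _

/-- A smooth vector valued function `g` satisfies `X (dg Y) - Y (dg X) = dg [X, Y]`. -/
theorem mvfderiv_mvfderiv_sub (hg : ContMDiffAt 𝓘(ℝ, E) 𝓘(ℝ, G) ∞ g x)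
    (hX : MDifferentiableAt 𝓘(ℝ, E) 𝓘(ℝ, E).tangent
      (fun y ↦ (⟨y, X y⟩ : TangentBundle 𝓘(ℝ, E) M)) x)
    (hY : MDifferentiableAt 𝓘(ℝ, E) 𝓘(ℝ, E).tangent
      (fun y ↦ (⟨y, Y y⟩ : TangentBundle 𝓘(ℝ, E) M)) x) :
    mvfderiv 𝓘(ℝ, E) (fun z ↦ mvfderiv 𝓘(ℝ, E) g z (Y z)) x (X x) -
      mvfderiv 𝓘(ℝ, E) (fun z ↦ mvfderiv 𝓘(ℝ, E) g z (X z)) x (Y x) =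
      mvfderiv 𝓘(ℝ, E) g x (VectorField.mlieBracket 𝓘(ℝ, E) X Y x) := by
  have hsymm := ((contDiffAt_comp_extChartAt_symm hg).of_le (m := 2)
    ENat.LEInfty.out).isSymmSndFDerivAt (by simp) (X x) (Y x)
  rw [mvfderiv_mvfderiv hg hX, mvfderiv_mvfderiv hg hY, mlieBracket_eq_fderiv_fieldInChart]
  refine Eq.trans ?_ (map_sub (mvfderiv 𝓘(ℝ, E) g x) _ _).symm
  refine (congrArg (· + _ - _) hsymm).trans ?_
  exact add_sub_add_left_eq_sub _ _ _

end LieBracket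

/-! ### Torsion of the pullback connection and the Gauss formula -/

section Torsion

variable {E : Type*} [NormedAddCommGroup E] [NormedSpace ℝ E] [FiniteDimensional ℝ E]
  {M : Type*} [TopologicalSpace M] [ChartedSpace E M] [IsManifold 𝓘(ℝ, E) ∞ M]
  {F : Type*} [NormedAddCommGroup F] [NormedSpace ℝ F] [FiniteDimensional ℝ F]
  {N : Type*} [TopologicalSpace N] [ChartedSpace F N] [IsManifold 𝓘(ℝ, F) ∞ N]
  {f : M → N} {X Y : Π x : M, TangentSpace 𝓘(ℝ, E) x} {x : M}

/-- The trivialization of the tangent bundle is the differential of the chart. -/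
theorem trivializationAt_snd_eq_mvfderiv {y₀ y : N}
    (hy : y ∈ (trivializationAt F (fun y : N ↦ TangentSpace 𝓘(ℝ, F) y) y₀).baseSet)
    (w : TangentSpace 𝓘(ℝ, F) y) :
    (trivializationAt F (fun y : N ↦ TangentSpace 𝓘(ℝ, F) y) y₀ ⟨y, w⟩).2 =
      mvfderiv 𝓘(ℝ, F) (extChartAt 𝓘(ℝ, F) y₀) y w := by
  have h := TangentBundle.continuousLinearMapAt_trivializationAt (I := 𝓘(ℝ, F)) (x₀ := y₀)
    (x := y) hy
  have h' := Trivialization.continuousLinearMapAt_apply_of_mem (R := ℝ) _ hy w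
  exact h'.symm.trans congr($h w)

/-- The canonical extensions of tangent vectors have constant coefficients in the chart at `x`, and
hence commute at `x`. -/
theorem mlieBracket_extend (a b : TangentSpace 𝓘(ℝ, E) x) :
    VectorField.mlieBracket 𝓘(ℝ, E) (FiberBundle.extend E a) (FiberBundle.extend E b) x = 0 := by
  have hconst (a : TangentSpace 𝓘(ℝ, E) x) :
      mvfderiv 𝓘(ℝ, E) (fun z ↦ mvfderiv 𝓘(ℝ, E) (extChartAt 𝓘(ℝ, E) x) z
        (FiberBundle.extend E a z)) x = 0 := by
    rw [← mvfderiv_const (c := (trivializationAt E (fun y : M ↦ TangentSpace 𝓘(ℝ, E) y) x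
      ⟨x, a⟩).2)]
    apply mvfderiv_congr
    filter_upwards [eventually_trivializationAt_extend a, (eventually_mem_baseSet (f := id) (x := x)
      (F := E) continuousAt_id)] with z hz hz'
    rw [← hz]
    exact (trivializationAt_snd_eq_mvfderiv hz' _).symm
  have h := mvfderiv_mvfderiv_sub (contMDiffAt_extChartAt (I := 𝓘(ℝ, E)) (x := x))
    (FiberBundle.mdifferentiableAt_extend 𝓘(ℝ, E) E a)
    (FiberBundle.mdifferentiableAt_extend 𝓘(ℝ, E) E b)
  rw [hconst, hconst] at h
  have hid := congr($(mfderiv_extChartAt_self (I := 𝓘(ℝ, E)) (x := x))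
    (VectorField.mlieBracket 𝓘(ℝ, E) (FiberBundle.extend E a) (FiberBundle.extend E b) x))
  exact hid.symm.trans (h.symm.trans (sub_self _))

theorem MDiffAlongAt.mfderiv (hf : ContMDiff 𝓘(ℝ, E) 𝓘(ℝ, F) ∞ f)
    (hY : MDifferentiableAt 𝓘(ℝ, E) 𝓘(ℝ, E).tangent
      (fun y ↦ (⟨y, Y y⟩ : TangentBundle 𝓘(ℝ, E) M)) x) :
    MDiffAlongAt (E := E) f (fun z ↦ mfderiv 𝓘(ℝ, E) 𝓘(ℝ, F) f z (Y z)) x :=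
  MDifferentiableAt.comp (I' := 𝓘(ℝ, E).tangent) (g := tangentMap 𝓘(ℝ, E) 𝓘(ℝ, F) f) x
    ((hf.contMDiff_tangentMap (m := ∞) (by simp)).mdifferentiable (by simp) _) hY

theorem eventually_trivializationAt_mfderiv (hf : ContMDiff 𝓘(ℝ, E) 𝓘(ℝ, F) ∞ f) :
    ∀ᶠ z in 𝓝 x, (trivializationAt F (fun y : N ↦ TangentSpace 𝓘(ℝ, F) y) (f x)
        ⟨f z, mfderiv 𝓘(ℝ, E) 𝓘(ℝ, F) f z (Y z)⟩).2 =
      mvfderiv 𝓘(ℝ, E) (extChartAt 𝓘(ℝ, F) (f x) ∘ f) z (Y z) := by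
  filter_upwards [eventually_mem_baseSet (F := F) (hf.continuous.continuousAt (x := x))] with z hz
  rw [trivializationAt_snd_eq_mvfderiv hz]
  exact (mfderiv_comp_apply (I' := 𝓘(ℝ, F)) (I'' := 𝓘(ℝ, F)) z
    (mdifferentiableAt_extChartAt hz) (hf.mdifferentiable (by simp) z) (Y z)).symm

variable [RiemannianBundle (fun y : N ↦ TangentSpace 𝓘(ℝ, F) y)]
  {nab : CovariantDerivative 𝓘(ℝ, F) F (fun y : N ↦ TangentSpace 𝓘(ℝ, F) y)}

/-- The pullback of the Levi-Civita connection is torsion-free. -/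
theorem IsLeviCivita.covDerivAlong_sub (hnab : IsLeviCivita nab)
    (hf : ContMDiff 𝓘(ℝ, E) 𝓘(ℝ, F) ∞ f)
    (hX : MDifferentiableAt 𝓘(ℝ, E) 𝓘(ℝ, E).tangent
      (fun y ↦ (⟨y, X y⟩ : TangentBundle 𝓘(ℝ, E) M)) x)
    (hY : MDifferentiableAt 𝓘(ℝ, E) 𝓘(ℝ, E).tangent
      (fun y ↦ (⟨y, Y y⟩ : TangentBundle 𝓘(ℝ, E) M)) x) :
    covDerivAlong nab f (fun z ↦ mfderiv 𝓘(ℝ, E) 𝓘(ℝ, F) f z (Y z)) x (X x) -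
      covDerivAlong nab f (fun z ↦ mfderiv 𝓘(ℝ, E) 𝓘(ℝ, F) f z (X z)) x (Y x) =
      mfderiv 𝓘(ℝ, E) 𝓘(ℝ, F) f x (VectorField.mlieBracket 𝓘(ℝ, E) X Y x) := by
  have hg : ContMDiffAt 𝓘(ℝ, E) 𝓘(ℝ, F) ∞ (extChartAt 𝓘(ℝ, F) (f x) ∘ f) x :=
    contMDiffAt_extChartAt.comp x (hf x)
  have hL := mvfderiv_mvfderiv_sub hg hX hY
  have hT := nab.torsion_eq_zero_iff.1 hnab.torsion_eq_zero
    (FiberBundle.mdifferentiableAt_extend 𝓘(ℝ, F) F (mfderiv 𝓘(ℝ, E) 𝓘(ℝ, F) f x (X x)))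
    (FiberBundle.mdifferentiableAt_extend 𝓘(ℝ, F) F (mfderiv 𝓘(ℝ, E) 𝓘(ℝ, F) f x (Y x)))
  rw [mlieBracket_extend, FiberBundle.extend_apply_self, FiberBundle.extend_apply_self,
    sub_eq_zero] at hT
  rw [covDerivAlong_eq, covDerivAlong_eq, hT, add_sub_add_right_eq_sub, ← map_sub,
    mvfderiv_congr (eventually_trivializationAt_mfderiv hf),
    mvfderiv_congr (eventually_trivializationAt_mfderiv hf), hL]
  have h := (eventually_trivializationAt_mfderiv (x := x)
    (Y := VectorField.mlieBracket 𝓘(ℝ, E) X Y) hf).self_of_nhds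
  have hx := FiberBundle.mem_baseSet_trivializationAt' (F := F)
    (E := fun y : N ↦ TangentSpace 𝓘(ℝ, F) y) (f x)
  rw [← h, Trivialization.symmL_apply _ hx]
  exact Trivialization.symm_apply_apply_mk _ hx _

end Torsion

section Gauss

variable {E : Type*} [NormedAddCommGroup E] [NormedSpace ℝ E] [FiniteDimensional ℝ E]
  {M : Type*} [TopologicalSpace M] [ChartedSpace E M] [IsManifold 𝓘(ℝ, E) ∞ M]
  [RiemannianBundle (fun x : M ↦ TangentSpace 𝓘(ℝ, E) x)]
  {F : Type*} [NormedAddCommGroup F] [NormedSpace ℝ F] [FiniteDimensional ℝ F]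
  {N : Type*} [TopologicalSpace N] [ChartedSpace F N] [IsManifold 𝓘(ℝ, F) ∞ N]
  [RiemannianBundle (fun y : N ↦ TangentSpace 𝓘(ℝ, F) y)]
  {nab : CovariantDerivative 𝓘(ℝ, E) E (fun x : M ↦ TangentSpace 𝓘(ℝ, E) x)}
  {nab' : CovariantDerivative 𝓘(ℝ, F) F (fun y : N ↦ TangentSpace 𝓘(ℝ, F) y)}
  {f : M → N} {X Y Z : Π x : M, TangentSpace 𝓘(ℝ, E) x} {x : M}

theorem inner_tangentPart (w : TangentSpace 𝓘(ℝ, F) (f x)) (v : TangentSpace 𝓘(ℝ, E) x) :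
    inner ℝ (tangentPart f x w) v = inner ℝ w (mfderiv 𝓘(ℝ, E) 𝓘(ℝ, F) f x v) :=
  LinearMap.adjoint_inner_left (mfderiv 𝓘(ℝ, E) 𝓘(ℝ, F) f x).toLinearMap v w

/-- The tangential part of the Gauss formula: the pullback of the ambient Levi-Civita connection,
projected to the submanifold, is torsion-free and metric, so the Koszul argument identifies it with
the Levi-Civita connection of the submanifold. -/
theorem tangentPart_covDerivAlong_mfderiv
    [IsContMDiffRiemannianBundle 𝓘(ℝ, F) ∞ F (fun y : N ↦ TangentSpace 𝓘(ℝ, F) y)]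
    (hnab : IsLeviCivita nab) (hnab' : IsLeviCivita nab')
    (hf : IsIsometricImmersion (E := E) (F := F) f)
    (hY : MDifferentiableAt 𝓘(ℝ, E) 𝓘(ℝ, E).tangent
      (fun y ↦ (⟨y, Y y⟩ : TangentBundle 𝓘(ℝ, E) M)) x) (v : TangentSpace 𝓘(ℝ, E) x) :
    tangentPart f x
      (covDerivAlong nab' f (fun z ↦ mfderiv 𝓘(ℝ, E) 𝓘(ℝ, F) f z (Y z)) x v) = nab Y x v := by
  -- `S X Y Z` is the difference of the two connections; it is symmetric in `X, Y` and
  -- skew-symmetric in `Y, Z`, hence zero.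
  let S (X Y Z : Π x : M, TangentSpace 𝓘(ℝ, E) x) : ℝ :=
    inner ℝ (covDerivAlong nab' f (fun z ↦ mfderiv 𝓘(ℝ, E) 𝓘(ℝ, F) f z (Y z)) x (X x))
      (mfderiv 𝓘(ℝ, E) 𝓘(ℝ, F) f x (Z x)) - inner ℝ (nab Y x (X x)) (Z x)
  let D (X : Π x : M, TangentSpace 𝓘(ℝ, E) x) : Prop :=
    MDifferentiableAt 𝓘(ℝ, E) 𝓘(ℝ, E).tangent (fun y ↦ (⟨y, X y⟩ : TangentBundle 𝓘(ℝ, E) M)) x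
  have symm {X Y Z} (hX : D X) (hY : D Y) : S X Y Z = S Y X Z := by
    have h1 := hnab'.covDerivAlong_sub hf.contMDiff hX hY
    have h2 := nab.torsion_eq_zero_iff.1 hnab.torsion_eq_zero hX hY
    have h3 := hf.isometric x (VectorField.mlieBracket 𝓘(ℝ, E) X Y x) (Z x)
    rw [← h1, ← h2, inner_sub_left, inner_sub_left] at h3
    simp only [S]
    linarith
  have skew {X Y Z} (hY : D Y) (hZ : D Z) : S X Y Z = - S X Z Y := by
    have h1 := hnab'.mvfderiv_inner_along (hf.contMDiff.mdifferentiable (by simp) x)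
      (MDiffAlongAt.mfderiv hf.contMDiff hY) (MDiffAlongAt.mfderiv hf.contMDiff hZ) (X x)
    have h2 := hnab.metric Y Z x hY hZ (X x)
    simp only [hf.isometric] at h1
    rw [h2, real_inner_comm (covDerivAlong _ _ _ _ _) (mfderiv _ _ _ _ (Y x)),
      real_inner_comm (nab Z x (X x))] at h1
    simp only [S]
    linarith
  have zero {X Y Z} (hX : D X) (hY : D Y) (hZ : D Z) : S X Y Z = 0 := by
    have h1 := skew (X := X) hY hZ
    have h2 := symm (Z := Y) hX hZ
    have h3 := skew (X := Z) hX hY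
    have h4 := symm (Z := X) hZ hY
    have h5 := skew (X := Y) hZ hX
    have h6 := symm (Z := Z) hY hX
    linarith
  refine ext_inner_right ℝ fun w ↦ ?_
  have h := zero (FiberBundle.mdifferentiableAt_extend 𝓘(ℝ, E) E v) hY
    (FiberBundle.mdifferentiableAt_extend 𝓘(ℝ, E) E w)
  simp only [S, FiberBundle.extend_apply_self] at h
  rw [inner_tangentPart]
  linarith

end Gauss

/-! ### The decomposition of `J` into tangential and normal parts -/

section Immersion

variable {E : Type*} [NormedAddCommGroup E] [NormedSpace ℝ E] [FiniteDimensional ℝ E]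
  {M : Type*} [TopologicalSpace M] [ChartedSpace E M] [IsManifold 𝓘(ℝ, E) ∞ M]
  {F : Type*} [NormedAddCommGroup F] [NormedSpace ℝ F] [FiniteDimensional ℝ F]
  {N : Type*} [TopologicalSpace N] [ChartedSpace F N] [IsManifold 𝓘(ℝ, F) ∞ N]
  {f : M → N} {W : Π x : M, TangentSpace 𝓘(ℝ, E) x} {x : M}

/-- A vector field on an immersed submanifold is differentiable if its push-forward is: in charts,
the differential has a left inverse at `x`, which makes it invertible near `x`. -/
theorem mdifferentiableAt_of_mdiffAlongAt_mfderiv (hf : ContMDiff 𝓘(ℝ, E) 𝓘(ℝ, F) ∞ f)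
    (hinj : Function.Injective (mfderiv 𝓘(ℝ, E) 𝓘(ℝ, F) f x))
    (hW : MDiffAlongAt (E := E) f (fun z ↦ mfderiv 𝓘(ℝ, E) 𝓘(ℝ, F) f z (W z)) x) :
    MDifferentiableAt 𝓘(ℝ, E) 𝓘(ℝ, E).tangent
      (fun y ↦ (⟨y, W y⟩ : TangentBundle 𝓘(ℝ, E) M)) x := by
  have hg : ContMDiffAt 𝓘(ℝ, E) 𝓘(ℝ, F) ∞ (extChartAt 𝓘(ℝ, F) (f x) ∘ f) x :=
    contMDiffAt_extChartAt.comp x (hf x)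
  set g : M → F := extChartAt 𝓘(ℝ, F) (f x) ∘ f with hg_def
  rw [mdiffAlongAt_iff (hf.mdifferentiable (by simp) x)] at hW
  let A : M → E →L[ℝ] F := fun z ↦ fderiv ℝ (g ∘ (extChartAt 𝓘(ℝ, E) x).symm)
    (extChartAt 𝓘(ℝ, E) x z)
  have hφ : MDifferentiableAt 𝓘(ℝ, E) 𝓘(ℝ, E) (extChartAt 𝓘(ℝ, E) x) x :=
    mdifferentiableAt_extChartAt (by simp)
  have hA : MDifferentiableAt 𝓘(ℝ, E) 𝓘(ℝ, E →L[ℝ] F) A x :=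
    MDifferentiableAt.comp (I' := 𝓘(ℝ, E)) x (((((contDiffAt_comp_extChartAt_symm hg).of_le (m := 2)
      ENat.LEInfty.out).fderiv_right (m := 1) (by norm_num)).differentiableAt
        (by simp)).mdifferentiableAt) hφ
  have hAinj : Function.Injective (A x) := by
    intro v w hvw
    simp only [A, ← mvfderiv_eq_fderiv_chart hg] at hvw
    have hcomp (u : E) : mvfderiv 𝓘(ℝ, E) g x u = mfderiv 𝓘(ℝ, E) 𝓘(ℝ, F) f x u := by
      refine (mfderiv_comp_apply (I' := 𝓘(ℝ, F)) (I'' := 𝓘(ℝ, F)) x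
        (mdifferentiableAt_extChartAt (by simp)) (hf.mdifferentiable (by simp) x) u).trans ?_
      exact congr($(mfderiv_extChartAt_self (I := 𝓘(ℝ, F)) (x := f x))
        (mfderiv 𝓘(ℝ, E) 𝓘(ℝ, F) f x u))
    rw [hcomp, hcomp] at hvw
    exact hinj hvw
  obtain ⟨Λ₀, hΛ₀⟩ := (A x).toLinearMap.exists_leftInverse_of_injective
    (LinearMap.ker_eq_bot.2 hAinj)
  let Λ : F →L[ℝ] E := LinearMap.toContinuousLinearMap Λ₀
  let B : M → E →L[ℝ] E := fun z ↦ Λ ∘L A z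
  have hBx : B x = 1 := by
    ext v
    exact congr($hΛ₀ v)
  have hB : MDifferentiableAt 𝓘(ℝ, E) 𝓘(ℝ, E →L[ℝ] E) B x :=
    mdifferentiableAt_const.clm_comp hA
  have hunit : ∀ᶠ z in 𝓝 x, IsUnit (B z) :=
    hB.continuousAt.eventually (Units.isOpen.mem_nhds (by
      rw [Set.mem_ofPred_eq, hBx]; exact isUnit_one))
  have hBinv : MDifferentiableAt 𝓘(ℝ, E) 𝓘(ℝ, E →L[ℝ] E) (fun z ↦ Ring.inverse (B z)) x := by
    have h : DifferentiableAt ℝ (Ring.inverse : (E →L[ℝ] E) → (E →L[ℝ] E)) (B x) := by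
      rw [hBx]
      exact differentiableAt_inverse (𝕜 := ℝ) isUnit_one
    exact MDifferentiableAt.comp (I' := 𝓘(ℝ, E →L[ℝ] E)) x h.mdifferentiableAt hB
  have hΛ : MDifferentiableAt 𝓘(ℝ, E) 𝓘(ℝ, F →L[ℝ] E) (fun _ : M ↦ Λ) x := mdifferentiableAt_const
  rw [mdifferentiableAt_section]
  refine (hBinv.clm_apply (hΛ.clm_apply hW)).congr_of_eventuallyEq ?_
  filter_upwards [hunit, eventually_trivializationAt_mfderiv (Y := W) hf,
    eventually_mvfderiv_eq_fderiv (Y := W) hg, eventually_mem_baseSet (f := id) (x := x) (F := E)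
      continuousAt_id, extChartAt_source_mem_nhds (I := 𝓘(ℝ, E)) x] with z hz h1 h2 h3 h4
  rw [fieldInChart_apply h4] at h2
  rw [h1, h2]
  refine (trivializationAt_snd_eq_mvfderiv h3 (W z)).trans ?_
  exact congr($((Ring.inverse_mul_cancel _ hz).symm)
    (mvfderiv 𝓘(ℝ, E) (extChartAt 𝓘(ℝ, E) x) z (W z)))

end Immersion

section Decomposition

variable {E : Type*} [NormedAddCommGroup E] [NormedSpace ℝ E] [FiniteDimensional ℝ E]
  {M : Type*} [TopologicalSpace M] [ChartedSpace E M] [IsManifold 𝓘(ℝ, E) ∞ M]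
  [RiemannianBundle (fun x : M ↦ TangentSpace 𝓘(ℝ, E) x)]
  {F : Type*} [NormedAddCommGroup F] [NormedSpace ℝ F] [FiniteDimensional ℝ F]
  {N : Type*} [TopologicalSpace N] [ChartedSpace F N] [IsManifold 𝓘(ℝ, F) ∞ N]
  [RiemannianBundle (fun y : N ↦ TangentSpace 𝓘(ℝ, F) y)]
  {nab : CovariantDerivative 𝓘(ℝ, E) E (fun x : M ↦ TangentSpace 𝓘(ℝ, E) x)}
  {nab' : CovariantDerivative 𝓘(ℝ, F) F (fun y : N ↦ TangentSpace 𝓘(ℝ, F) y)}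
  {J : Π y : N, TangentSpace 𝓘(ℝ, F) y →L[ℝ] TangentSpace 𝓘(ℝ, F) y} {p q : ℕ}
  {f : M → N} {X Y : Π x : M, TangentSpace 𝓘(ℝ, E) x} {x : M} {r : ℕ}
  {Φ : NormalFrame (E := E) (F := F) f r}

theorem IsIsometricImmersion.injective (hf : IsIsometricImmersion (E := E) (F := F) f) :
    Function.Injective (mfderiv 𝓘(ℝ, E) 𝓘(ℝ, F) f x) := by
  refine (injective_iff_map_eq_zero _).2 fun v hv ↦ ?_
  have h := hf.isometric x v v
  rw [hv, inner_zero_left] at h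
  exact inner_self_eq_zero.1 h.symm

theorem tangentPart_mfderiv (hf : IsIsometricImmersion (E := E) (F := F) f)
    (v : TangentSpace 𝓘(ℝ, E) x) :
    tangentPart f x (mfderiv 𝓘(ℝ, E) 𝓘(ℝ, F) f x v) = v :=
  ext_inner_right ℝ fun w ↦ by rw [inner_tangentPart, hf.isometric]

theorem NormalFrame.inner_mfderiv (hx : x ∈ Φ.dom) (α : Fin r) (v : TangentSpace 𝓘(ℝ, E) x) :
    inner ℝ (mfderiv 𝓘(ℝ, E) 𝓘(ℝ, F) f x v) (Φ.n α x) = 0 := by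
  have h : Φ.n α x ∈ (tangentRange (E := E) (F := F) f x)ᗮ :=
    Φ.span_eq x hx ▸ Submodule.subset_span ⟨α, rfl⟩
  exact (Submodule.mem_orthogonal _ _).1 h _ ⟨v, rfl⟩

theorem NormalFrame.tangentPart_eq_zero (hx : x ∈ Φ.dom) (α : Fin r) :
    tangentPart (E := E) f x (Φ.n α x) = 0 :=
  ext_inner_right ℝ fun v ↦ by
    rw [inner_tangentPart, real_inner_comm, Φ.inner_mfderiv hx, inner_zero_left]

/-- The decomposition `JX = TX + ∑ α, u_α(X) n_α`. -/
theorem apply_mfderiv_eq (hf : IsIsometricImmersion (E := E) (F := F) f) (hx : x ∈ Φ.dom)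
    (v : TangentSpace 𝓘(ℝ, E) x) :
    J (f x) (mfderiv 𝓘(ℝ, E) 𝓘(ℝ, F) f x v) =
      mfderiv 𝓘(ℝ, E) 𝓘(ℝ, F) f x (tangT J f x v) + ∑ α, uForm J Φ α x v • Φ.n α x := by
  have h := sub_tangentPart_mem_normal hf x (J (f x) (mfderiv 𝓘(ℝ, E) 𝓘(ℝ, F) f x v))
  rw [← Φ.span_eq x hx, Submodule.mem_span_range_iff_exists_fun] at h
  obtain ⟨c, hc⟩ := h
  have hu (α : Fin r) : uForm J Φ α x v = c α := by
    rw [← (Φ.orthonormal x hx).inner_right_fintype c α, hc, inner_sub_right,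
      real_inner_comm (mfderiv _ _ _ _ _), Φ.inner_mfderiv hx, sub_zero, real_inner_comm]
    rfl
  simp only [hu, hc]
  exact (add_sub_cancel _ _).symm

theorem NormalFrame.mdiffAlongAt (hx : x ∈ Φ.dom) (α : Fin r) :
    MDiffAlongAt (E := E) f (Φ.n α) x :=
  ((Φ.smooth α).contMDiffAt (Φ.isOpen_dom.mem_nhds hx)).mdifferentiableAt (by simp)

/-- `TY` is differentiable because its push-forward is `JY - ∑ α, u_α(Y) n_α`. -/
theorem mdifferentiableAt_tangT
    [IsContMDiffRiemannianBundle 𝓘(ℝ, F) ∞ F (fun y : N ↦ TangentSpace 𝓘(ℝ, F) y)]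
    (hJ : IsMetallicRiemannian p q J) (hf : IsIsometricImmersion (E := E) (F := F) f)
    (hx : x ∈ Φ.dom) (hY : MDifferentiableAt 𝓘(ℝ, E) 𝓘(ℝ, E).tangent
      (fun y ↦ (⟨y, Y y⟩ : TangentBundle 𝓘(ℝ, E) M)) x) :
    MDifferentiableAt 𝓘(ℝ, E) 𝓘(ℝ, E).tangent
      (fun y ↦ (⟨y, tangT J f y (Y y)⟩ : TangentBundle 𝓘(ℝ, E) M)) x := by
  have hfx : MDifferentiableAt 𝓘(ℝ, E) 𝓘(ℝ, F) f x := hf.contMDiff.mdifferentiable (by simp) x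
  have hJY := hJ.mdiffAlongAt hfx (MDiffAlongAt.mfderiv hf.contMDiff hY)
  have hu (α : Fin r) : MDifferentiableAt 𝓘(ℝ, E) 𝓘(ℝ) (fun z ↦ -uForm J Φ α z (Y z)) x :=
    (hJY.inner (Φ.mdiffAlongAt hx α)).neg
  refine mdifferentiableAt_of_mdiffAlongAt_mfderiv hf.contMDiff hf.injective ?_
  refine (hJY.add hfx (MDiffAlongAt.sum Finset.univ hfx
    fun α ↦ MDiffAlongAt.smul hfx (hu α) (Φ.mdiffAlongAt hx α))).congr ?_
  filter_upwards [Φ.isOpen_dom.mem_nhds hx] with z hz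
  rw [apply_mfderiv_eq hf hz]
  simp

/-- The tangential part of `J ∇̄_v Y = ∇̄_v (TY) + ∇̄_v (∑ α, u_α(Y) n_α)`, by the formulas of Gauss
and Weingarten. -/
theorem tangentPart_apply_covDerivAlong
    [IsContMDiffRiemannianBundle 𝓘(ℝ, F) ∞ F (fun y : N ↦ TangentSpace 𝓘(ℝ, F) y)]
    (hnab : IsLeviCivita nab) (hnab' : IsLeviCivita nab')
    (hJ : IsLocallyMetallic p q J nab') (hf : IsIsometricImmersion (E := E) (F := F) f)
    (hx : x ∈ Φ.dom) (hY : MDifferentiableAt 𝓘(ℝ, E) 𝓘(ℝ, E).tangent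
      (fun y ↦ (⟨y, Y y⟩ : TangentBundle 𝓘(ℝ, E) M)) x) (v : TangentSpace 𝓘(ℝ, E) x) :
    tangentPart f x (J (f x)
      (covDerivAlong nab' f (fun z ↦ mfderiv 𝓘(ℝ, E) 𝓘(ℝ, F) f z (Y z)) x v)) =
      nab (fun z ↦ tangT J f z (Y z)) x v -
        ∑ α, uForm J Φ α x (Y x) • shapeOp nab' Φ α x v := by
  have hfx : MDifferentiableAt 𝓘(ℝ, E) 𝓘(ℝ, F) f x := hf.contMDiff.mdifferentiable (by simp) x
  have hYf := MDiffAlongAt.mfderiv hf.contMDiff hY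
  have hJY := hJ.metallic.mdiffAlongAt hfx hYf
  have hTY := mdifferentiableAt_tangT hJ.metallic hf hx hY
  have hu (α : Fin r) : MDifferentiableAt 𝓘(ℝ, E) 𝓘(ℝ) (fun z ↦ uForm J Φ α z (Y z)) x :=
    hJY.inner (Φ.mdiffAlongAt hx α)
  have hun (α : Fin r) := MDiffAlongAt.smul hfx (hu α) (Φ.mdiffAlongAt hx α)
  have hcongr : ∀ᶠ z in 𝓝 x, J (f z) (mfderiv 𝓘(ℝ, E) 𝓘(ℝ, F) f z (Y z)) =
      mfderiv 𝓘(ℝ, E) 𝓘(ℝ, F) f z (tangT J f z (Y z)) + ∑ α, uForm J Φ α z (Y z) • Φ.n α z := by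
    filter_upwards [Φ.isOpen_dom.mem_nhds hx] with z hz
    exact apply_mfderiv_eq hf hz _
  rw [← hJ.covDerivAlong_eq hfx hYf, covDerivAlong_congr nab' hcongr,
    covDerivAlong_add nab' hfx (MDiffAlongAt.mfderiv hf.contMDiff hTY)
      (MDiffAlongAt.sum Finset.univ hfx hun), covDerivAlong_sum nab' Finset.univ hfx hun,
    map_add, map_sum, tangentPart_covDerivAlong_mfderiv hnab hnab' hf hTY, sub_eq_add_neg,
    ← Finset.sum_neg_distrib]
  congr 1
  refine Finset.sum_congr rfl fun α _ ↦ ?_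
  rw [covDerivAlong_smul nab' hfx (hu α) (Φ.mdiffAlongAt hx α), map_add, map_smul, map_smul,
    Φ.tangentPart_eq_zero hx, smul_zero, zero_add, shapeOp, smul_neg, neg_neg]

/-- The defect in the formula characterizing the integrability of `D₂` is `T [X, Y]`. -/
theorem tangT_mlieBracket
    [IsContMDiffRiemannianBundle 𝓘(ℝ, F) ∞ F (fun y : N ↦ TangentSpace 𝓘(ℝ, F) y)]
    (hnab : IsLeviCivita nab) (hnab' : IsLeviCivita nab')
    (hJ : IsLocallyMetallic p q J nab') (hf : IsIsometricImmersion (E := E) (F := F) f)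
    (hx : x ∈ Φ.dom) (hX : MDifferentiableAt 𝓘(ℝ, E) 𝓘(ℝ, E).tangent
      (fun y ↦ (⟨y, X y⟩ : TangentBundle 𝓘(ℝ, E) M)) x)
    (hY : MDifferentiableAt 𝓘(ℝ, E) 𝓘(ℝ, E).tangent
      (fun y ↦ (⟨y, Y y⟩ : TangentBundle 𝓘(ℝ, E) M)) x) :
    tangT J f x (VectorField.mlieBracket 𝓘(ℝ, E) X Y x) =
      (nab (fun z ↦ tangT J f z (Y z)) x (X x) - nab (fun z ↦ tangT J f z (X z)) x (Y x)) -
      ∑ α, (uForm J Φ α x (Y x) • shapeOp nab' Φ α x (X x) -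
        uForm J Φ α x (X x) • shapeOp nab' Φ α x (Y x)) := by
  rw [tangT, ← hnab'.covDerivAlong_sub hf.contMDiff hX hY, map_sub, map_sub,
    tangentPart_apply_covDerivAlong hnab hnab' hJ hf hx hX,
    tangentPart_apply_covDerivAlong hnab hnab' hJ hf hx hY, Finset.sum_sub_distrib]
  abel

end Decomposition

/-! ### Integrability of the two distributions -/

section Integrability

variable {E : Type*} [NormedAddCommGroup E] [NormedSpace ℝ E] [FiniteDimensional ℝ E]
  {M : Type*} [TopologicalSpace M] [ChartedSpace E M] [IsManifold 𝓘(ℝ, E) ∞ M]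
  [RiemannianBundle (fun x : M ↦ TangentSpace 𝓘(ℝ, E) x)]
  {F : Type*} [NormedAddCommGroup F] [NormedSpace ℝ F] [FiniteDimensional ℝ F]
  {N : Type*} [TopologicalSpace N] [ChartedSpace F N] [IsManifold 𝓘(ℝ, F) ∞ N]
  [RiemannianBundle (fun y : N ↦ TangentSpace 𝓘(ℝ, F) y)]
  {nab : CovariantDerivative 𝓘(ℝ, E) E (fun x : M ↦ TangentSpace 𝓘(ℝ, E) x)}
  {J : Π y : N, TangentSpace 𝓘(ℝ, F) y →L[ℝ] TangentSpace 𝓘(ℝ, F) y} {p q : ℕ}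
  {f : M → N} {D₁ D₂ : Π x : M, Submodule ℝ (TangentSpace 𝓘(ℝ, E) x)}
  {X Y : Π x : M, TangentSpace 𝓘(ℝ, E) x} {x : M} {r : ℕ}
  {Φ : NormalFrame (E := E) (F := F) f r} {v w : TangentSpace 𝓘(ℝ, E) x}

theorem IsSmoothField.mdifferentiableAt (hX : IsSmoothField X) (x : M) :
    MDifferentiableAt 𝓘(ℝ, E) 𝓘(ℝ, E).tangent
      (fun y ↦ (⟨y, X y⟩ : TangentBundle 𝓘(ℝ, E) M)) x :=
  ContMDiff.mdifferentiable hX (by simp) x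

theorem IsSemiSlant.exists_apply_mfderiv_eq (hD : IsSemiSlant J f D₁ D₂) (hv : v ∈ D₁ x) :
    ∃ w ∈ D₁ x, J (f x) (mfderiv 𝓘(ℝ, E) 𝓘(ℝ, F) f x v) = mfderiv 𝓘(ℝ, E) 𝓘(ℝ, F) f x w := by
  have h : J (f x) (mfderiv 𝓘(ℝ, E) 𝓘(ℝ, F) f x v) ∈
      (D₁ x).map (mfderiv 𝓘(ℝ, E) 𝓘(ℝ, F) f x).toLinearMap := by
    rw [← hD.invariant x]
    exact ⟨_, ⟨v, hv, rfl⟩, rfl⟩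
  obtain ⟨w, hw, h⟩ := h
  exact ⟨w, hw, h.symm⟩

theorem IsSemiSlant.exists_mfderiv_eq_apply (hD : IsSemiSlant J f D₁ D₂) (hv : v ∈ D₁ x) :
    ∃ w ∈ D₁ x, mfderiv 𝓘(ℝ, E) 𝓘(ℝ, F) f x v = J (f x) (mfderiv 𝓘(ℝ, E) 𝓘(ℝ, F) f x w) := by
  have h : mfderiv 𝓘(ℝ, E) 𝓘(ℝ, F) f x v ∈
      ((D₁ x).map (mfderiv 𝓘(ℝ, E) 𝓘(ℝ, F) f x).toLinearMap).map (J (f x)).toLinearMap := by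
    rw [hD.invariant x]
    exact ⟨v, hv, rfl⟩
  obtain ⟨_, ⟨w, hw, rfl⟩, h⟩ := h
  exact ⟨w, hw, h.symm⟩

theorem IsSemiSlant.mem_of_inner_eq_zero (hD : IsSemiSlant J f D₁ D₂)
    (hw : ∀ v ∈ D₁ x, inner ℝ v w = 0) : w ∈ D₂ x := by
  obtain ⟨a, ha, b, hb, rfl⟩ := Submodule.mem_sup.1 (hD.sup_eq_top x ▸ Submodule.mem_top : w ∈ _)
  have h := hw a ha
  rw [inner_add_right, (hD.orthogonal x).inner_eq ha hb, add_zero, inner_self_eq_zero] at h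
  rwa [h, zero_add]

/-- `T` is symmetric. -/
theorem inner_tangT (hJ : IsMetallicRiemannian p q J) :
    inner ℝ (tangT J f x w) v = inner ℝ w (tangT J f x v) := by
  rw [tangT, inner_tangentPart, hJ.compatible, ← real_inner_comm, ← inner_tangentPart,
    real_inner_comm]
  rfl

/-- As `T` is symmetric and maps `D₁` onto itself, `Tw` is orthogonal to `D₁` if and only if `w` is. -/
theorem IsSemiSlant.starProjection_tangT_eq_zero_iff (hD : IsSemiSlant J f D₁ D₂)
    (hJ : IsMetallicRiemannian p q J) (hf : IsIsometricImmersion (E := E) (F := F) f) :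
    (D₁ x).starProjection (tangT J f x w) = 0 ↔ w ∈ D₂ x := by
  rw [Submodule.starProjection_apply_eq_zero_iff, Submodule.mem_orthogonal]
  refine ⟨fun h ↦ hD.mem_of_inner_eq_zero fun v hv ↦ ?_, fun hw v hv ↦ ?_⟩
  · obtain ⟨u, hu, huv⟩ := hD.exists_mfderiv_eq_apply hv
    have h' := h u hu
    rwa [← inner_tangT hJ, tangT, ← huv, tangentPart_mfderiv hf] at h'
  · obtain ⟨u, hu, huv⟩ := hD.exists_apply_mfderiv_eq hv
    rw [← inner_tangT hJ, tangT, huv, tangentPart_mfderiv hf]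
    exact (hD.orthogonal x).inner_eq hu hw

/-- The normal part of `Jw` vanishes exactly for `w` in `D₁`: a nonzero vector of `D₂` with tangential
image would make the slant angle zero. -/
theorem IsSemiSlant.mem_iff_uForm_eq_zero (hD : IsSemiSlant J f D₁ D₂)
    (hJ : IsMetallicRiemannian p q J) (hf : IsIsometricImmersion (E := E) (F := F) f)
    (hx : x ∈ Φ.dom) : w ∈ D₁ x ↔ ∀ α, uForm J Φ α x w = 0 := by
  refine ⟨fun hw α ↦ ?_, fun h ↦ ?_⟩
  · obtain ⟨u, -, hu⟩ := hD.exists_apply_mfderiv_eq hw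
    rw [uForm, hu, Φ.inner_mfderiv hx]
  have hw := apply_mfderiv_eq (J := J) hf hx w
  simp only [h, zero_smul, Finset.sum_const_zero, add_zero] at hw
  obtain ⟨a, ha, b, hb, rfl⟩ := Submodule.mem_sup.1 (hD.sup_eq_top x ▸ Submodule.mem_top : w ∈ _)
  obtain ⟨c, hc, hac⟩ := hD.exists_apply_mfderiv_eq ha
  by_cases hb0 : b = 0
  · rwa [hb0, add_zero]
  obtain ⟨t, ht⟩ : ∃ t, J (f x) (mfderiv 𝓘(ℝ, E) 𝓘(ℝ, F) f x b) =
      mfderiv 𝓘(ℝ, E) 𝓘(ℝ, F) f x t := by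
    refine ⟨tangT J f x (a + b) - c, ?_⟩
    rw [map_sub, ← hw, ← hac, map_add, map_add, add_sub_cancel_left]
  have hTb : tangT J f x b = t := by rw [tangT, ht, tangentPart_mfderiv hf]
  have htD : t ∈ D₂ x := hD.mem_of_inner_eq_zero fun v hv ↦ by
    rw [← hTb]
    exact Submodule.inner_right_of_mem_orthogonal hv
      ((D₁ x).starProjection_apply_eq_zero_iff.1
        ((hD.starProjection_tangT_eq_zero_iff hJ hf).2 hb))
  have hne : mfderiv 𝓘(ℝ, E) 𝓘(ℝ, F) f x t ≠ 0 := by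
    intro h0
    -- `J` is injective since `J (J v) - p J v = q v` with `q ≠ 0`.
    have hsq := hJ.sq (f x) (mfderiv 𝓘(ℝ, E) 𝓘(ℝ, F) f x b)
    rw [ht, h0, map_zero, smul_zero, zero_add] at hsq
    have hfb := (smul_eq_zero.1 hsq.symm).resolve_left (Nat.cast_ne_zero.2 hJ.q_pos.ne')
    exact hb0 (hf.injective (hfb.trans (map_zero _).symm))
  obtain ⟨θ, hθ, hslant⟩ := hD.slant
  have hangle := hslant x b hb hb0
  rw [hTb, Submodule.starProjection_eq_self_iff.2 htD, ht, InnerProductGeometry.angle_self hne]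
    at hangle
  exact absurd hangle.symm hθ

theorem uForm_sub (α : Fin r) : uForm J Φ α x (v - w) = uForm J Φ α x v - uForm J Φ α x w := by
  simp only [uForm, map_sub, inner_sub_left]

/-- For sections `X, Y` of `D₁` the functions `u_α(X)` vanish, so that only the terms
`-u_α(∇_Y X)` and `-u_α(∇_X Y)` survive. -/
theorem IsSemiSlant.covDerivForm_sub (hD : IsSemiSlant J f D₁ D₂) (hnab : IsLeviCivita nab)
    (hJ : IsMetallicRiemannian p q J) (hf : IsIsometricImmersion (E := E) (F := F) f)
    (hx : x ∈ Φ.dom) (hX : IsSmoothSection D₁ X) (hY : IsSmoothSection D₁ Y) (α : Fin r) :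
    covDerivForm nab (uForm J Φ α) Y X x - covDerivForm nab (uForm J Φ α) X Y x =
      uForm J Φ α x (VectorField.mlieBracket 𝓘(ℝ, E) X Y x) := by
  have hu {Z : Π x : M, TangentSpace 𝓘(ℝ, E) x} (hZ : IsSmoothSection D₁ Z) :
      mvfderiv 𝓘(ℝ, E) (fun z ↦ uForm J Φ α z (Z z)) x = 0 := by
    rw [← mvfderiv_const (c := (0 : ℝ))]
    apply mvfderiv_congr
    filter_upwards [Φ.isOpen_dom.mem_nhds hx] with z hz
    exact (hD.mem_iff_uForm_eq_zero hJ hf hz).1 (hZ.2 z) α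
  have hT := nab.torsion_eq_zero_iff.1 hnab.torsion_eq_zero (hX.1.mdifferentiableAt x)
    (hY.1.mdifferentiableAt x)
  rw [covDerivForm, covDerivForm, hu hX, hu hY, ← hT, uForm_sub]
  simp only [zero_apply]
  ring

end Integrability

end SemiSlant

theorem mainTheorem5
    {E : Type*} [NormedAddCommGroup E] [NormedSpace ℝ E] [FiniteDimensional ℝ E]
    {M : Type*} [TopologicalSpace M] [T2Space M] [SecondCountableTopology M]
    [ChartedSpace E M] [IsManifold 𝓘(ℝ, E) ∞ M]
    [RiemannianBundle (fun x : M ↦ TangentSpace 𝓘(ℝ, E) x)]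
    [IsContMDiffRiemannianBundle 𝓘(ℝ, E) ∞ E (fun x : M ↦ TangentSpace 𝓘(ℝ, E) x)]
    {F : Type*} [NormedAddCommGroup F] [NormedSpace ℝ F] [FiniteDimensional ℝ F]
    {N : Type*} [TopologicalSpace N] [T2Space N] [SecondCountableTopology N]
    [ChartedSpace F N] [IsManifold 𝓘(ℝ, F) ∞ N]
    [RiemannianBundle (fun y : N ↦ TangentSpace 𝓘(ℝ, F) y)]
    [IsContMDiffRiemannianBundle 𝓘(ℝ, F) ∞ F (fun y : N ↦ TangentSpace 𝓘(ℝ, F) y)]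
    -- the Levi-Civita connections of the submanifold `M` and of the ambient manifold `N`
    (nab : CovariantDerivative 𝓘(ℝ, E) E (fun x : M ↦ TangentSpace 𝓘(ℝ, E) x))
    (hnab : SemiSlant.IsLeviCivita nab)
    (nab' : CovariantDerivative 𝓘(ℝ, F) F (fun y : N ↦ TangentSpace 𝓘(ℝ, F) y))
    (hnab' : SemiSlant.IsLeviCivita nab')
    -- the ambient manifold is locally metallic (locally Golden if `p = q = 1`)
    (p q : ℕ) (J : Π y : N, TangentSpace 𝓘(ℝ, F) y →L[ℝ] TangentSpace 𝓘(ℝ, F) y)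
    (hJ : SemiSlant.IsLocallyMetallic p q J nab')
    -- `M` is a semi-slant submanifold
    (f : M → N) (hf : SemiSlant.IsIsometricImmersion (E := E) (F := F) f)
    (D₁ D₂ : Π x : M, Submodule ℝ (TangentSpace 𝓘(ℝ, E) x))
    (hD : SemiSlant.IsSemiSlant J f D₁ D₂)
    -- local orthonormal frames of the normal bundle, over open sets covering `M`
    (r : ℕ) {ι : Type*} (Φ : ι → SemiSlant.NormalFrame (E := E) (F := F) f r)
    (hΦ : ∀ x, ∃ i, x ∈ (Φ i).dom) :
    (SemiSlant.IsIntegrable D₁ ↔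
      ∀ X Y : Π x : M, TangentSpace 𝓘(ℝ, E) x,
        SemiSlant.IsSmoothSection D₁ X → SemiSlant.IsSmoothSection D₁ Y →
        ∀ i, ∀ x ∈ (Φ i).dom, ∀ α : Fin r,
          SemiSlant.covDerivForm nab (SemiSlant.uForm J (Φ i) α) Y X x =
            SemiSlant.covDerivForm nab (SemiSlant.uForm J (Φ i) α) X Y x) ∧
    (SemiSlant.IsIntegrable D₂ ↔
      ∀ X Y : Π x : M, TangentSpace 𝓘(ℝ, E) x,
        SemiSlant.IsSmoothSection D₂ X → SemiSlant.IsSmoothSection D₂ Y →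
        ∀ i, ∀ x ∈ (Φ i).dom,
          (D₁ x).starProjection
              (nab (fun z ↦ SemiSlant.tangT J f z (Y z)) x (X x) -
                nab (fun z ↦ SemiSlant.tangT J f z (X z)) x (Y x)) =
            ∑ α : Fin r,
              (SemiSlant.uForm J (Φ i) α x (Y x) •
                  (D₁ x).starProjection (SemiSlant.shapeOp nab' (Φ i) α x (X x)) -
                SemiSlant.uForm J (Φ i) α x (X x) •
                  (D₁ x).starProjection (SemiSlant.shapeOp nab' (Φ i) α x (Y x)))) := by
  refine ⟨⟨fun h X Y hX hY i x hx α ↦ ?_, fun h X Y hX hY x ↦ ?_⟩,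
    ⟨fun h X Y hX hY i x hx ↦ ?_, fun h X Y hX hY x ↦ ?_⟩⟩
  · rw [← sub_eq_zero, hD.covDerivForm_sub hnab hJ.metallic hf hx hX hY]
    exact (hD.mem_iff_uForm_eq_zero hJ.metallic hf hx).1 (h X Y hX hY x) α
  · obtain ⟨i, hx⟩ := hΦ x
    refine (hD.mem_iff_uForm_eq_zero hJ.metallic hf hx).2 fun α ↦ ?_
    rw [← hD.covDerivForm_sub hnab hJ.metallic hf hx hX hY, sub_eq_zero]
    exact h X Y hX hY i x hx α
  · have hT := (hD.starProjection_tangT_eq_zero_iff hJ.metallic hf).2 (h X Y hX hY x)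
    rw [SemiSlant.tangT_mlieBracket hnab hnab' hJ hf hx (hX.1.mdifferentiableAt x)
      (hY.1.mdifferentiableAt x), map_sub, sub_eq_zero, map_sum] at hT
    simpa only [map_sub, map_smul] using hT
  · obtain ⟨i, hx⟩ := hΦ x
    rw [← hD.starProjection_tangT_eq_zero_iff hJ.metallic hf,
      SemiSlant.tangT_mlieBracket hnab hnab' hJ hf hx (hX.1.mdifferentiableAt x)
        (hY.1.mdifferentiableAt x), map_sub, sub_eq_zero, map_sum]
    simpa only [map_sub, map_smul] using h X Y hX hY i x hx
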